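/- Let $k$ be a number field with algebraic closure $\bar k$ and $G_F=\mathrm{Gal}(\bar k/F)$ for $k\subseteq F\subseteq\bar k$. Let $f=f_2f_3\cdot(x-r_6)\in k[x]$ with $f_2,f_3$ irreducible over $k$ of degrees $2$ and $3$ and $r_6\in k$. Let $r_1,r_2$ be the roots of $f_2$ and $r_3,r_4,r_5$ the roots of $f_3$ in $\bar k$. Let $\delta$ be a unit of $A_f=k[x]/(f)$, and fix square roots $z_i\in\bar k$ of $\delta(r_i)$ for $1\le i\le 6$. Assume that $\delta(r_1)$ is a square in $k(r_1)$, with $z_1=w(r_1)$ and $z_2=w(r_2)$ for one polynomial $w\in k[x]$, and that $z_1z_2\cdots z_6\in k$ (that is, the norm of $\delta$ is a square in $k$). *The surface and its lines.* Let $V=V_\delta\subset\mathbb P^5_{\bar k}$ be defined by the three quadratic forms $C_3,C_4,C_5$ in $a_0,\dots,a_5$, where $C_j$ is the coefficient of $x^j$ in the remainder of $\delta\cdot(\sum_{i=0}^5 a_ix^i)^2$ modulo $f$. For $s\in(\mathbb Z/2)^6$ let $\gamma_s$ be the polynomial of degree at most $5$ with $\gamma_s(r_i)=(-1)^{s_i}/z_i$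 for all $i$, and let $L_s\subset V$ be the line formed by the classes modulo $f$ of the polynomials $\gamma_s(x)(tx+u)$, $t,u\in\bar k$. It depends only on $s$ modulo $(1,1,1,1,1,1)$, which gives $32$ lines. Put $$E=\bigl(L_{(0,0,0,1,1,0)}+L_{(0,0,0,1,1,1)}\bigr)-\bigl(L_{(0,0,1,0,0,0)}+L_{(0,0,1,0,0,1)}\bigr).$$ For $3\le i\le 6$ let $p_i$, respectively $q_i$, be a linear form over $\bar k$ whose hyperplane section of $V$ is, as a divisor, the sum of the eight lines $L_s$ with $s_1=s_2=0$ and $s_i=0$, respectively $s_1=s_2=0$ and $s_i=1$. *The Galois action.* Each $\sigma\in G_k$ acts on the coefficients of polynomials and on divisors of $V$. We say that $\sigma$ induces $s\cdot\pi$, with $s\in(\mathbb Z/2)^6$ and $\pi\in S_6$, if $\sigma r_i=r_{\pi(i)}$ and $\sigma z_i=(-1)^{s_{\pi(i)}}z_{\pi(i)}$ for all $i$. Let $H_{96}\subset(\mathbb Z/2)^6\rtimes S_6$ be the group generated by the sign vectors $(0,0,1,0,0,1)$, $(0,0,1,1,1,1)$ and the permutations $(12)$, $(345)$, $(34)$.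 It consists of the $s\cdot\pi$ such that $s_1=s_2=0$, $\sum_i s_i=0$ and $\pi$ preserves $\{1,2\}$, $\{3,4,5\}$ and $\{6\}$. Assume the following conditions. 1. For $3\le i\le 6$, the forms $p_i$ and $q_i$ have coefficients in $k(r_1,z_i,z_6)$, and $\sigma p_i=q_i$ for every $\sigma\in G_k$ inducing $(0,0,1,1,1,1)$. 2. For $3\le i\le 6$ and every $\sigma\in G_k$ inducing an element $s\cdot\pi$ of $H_{96}$, with $j=\pi(i)$: if $s_j=0$, then $\sigma p_i=p_j$ and $\sigma q_i=q_j$; if $s_j=1$, then $\sigma p_i=q_j$ and $\sigma q_i=p_j$. 3. For $3\le i,j\le 5$, $p_iq_i=p_jq_j$ on $V$ (that is, in the homogeneous coordinate ring of $V$). Then $V$ is integral, the rational function $$h=1+\frac{p_3}{p_4}+\frac{q_5}{p_4}+\frac{p_3}{p_5}$$ on $V$ is not zero, and the divisor $E-\operatorname{div}(h)$ is defined over $L=k(z_6)=k(\sqrt{\delta(r_6)})$, that is, $\tau(E-\operatorname{div}(h))=E-\operatorname{div}(h)$ for every $\tau\in G_L$. -/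

import Mathlib

open scoped Polynomial IntermediateField

noncomputable section

namespace KThree

universe u v

/- Indices run over `Fin 6 = {0, …, 5}`; the usual numbering `1, …, 6` is shifted by one.  So
`0, 1` are the two roots of the quadratic factor, `2, 3, 4` the three roots of the cubic factor and
`5` the rational root. -/

section Surface

variable {k : Type u} [Field k]

/-- The quadratic form `C_j` in `a_0, …, a_5`: the coefficient of `x ^ j` in the remainder of
`δ q²` modulo `f`, where `q = ∑ a_i x ^ i` (reduction modulo `f` is reduction modulo the monic
polynomial `f / leadingCoeff f`). -/
def quadric (f δ : k[X]) (j : ℕ) : MvPolynomial (Fin 6) k :=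
  ((δ.map MvPolynomial.C *
      (∑ i : Fin 6, Polynomial.C (MvPolynomial.X i) * Polynomial.X ^ (i : ℕ)) ^ 2) %ₘ
    (f * Polynomial.C f.leadingCoeff⁻¹).map MvPolynomial.C).coeff j

variable (K : Type v) [Field K] [Algebra k K]

/-- The homogeneous ideal `(C₃, C₄, C₅)` over the extension `K` of `k`; it defines `V_δ` in the
five-dimensional projective space over `K`. -/
def surfaceIdeal (f δ : k[X]) : Ideal (MvPolynomial (Fin 6) K) :=
  Ideal.span {P | ∃ j ∈ ({3, 4, 5} : Set ℕ), P = (quadric f δ j).map (algebraMap k K)}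

/-- The homogeneous coordinate ring of `V_δ` over `K`. -/
abbrev CoordRing (f δ : k[X]) : Type v := MvPolynomial (Fin 6) K ⧸ surfaceIdeal K f δ

/-- The class of a polynomial in the homogeneous coordinate ring. -/
abbrev toCoord (f δ : k[X]) : MvPolynomial (Fin 6) K →+* CoordRing K f δ :=
  Ideal.Quotient.mk (surfaceIdeal K f δ)

/-- The field of fractions of the homogeneous coordinate ring (a field once `V_δ` is integral).
Its elements of degree `0` are the rational functions on `V_δ`. -/
abbrev FracField (f δ : k[X]) : Type v := FractionRing (CoordRing K f δ)

/-- A prime divisor of `V_δ`, given by its homogeneous prime ideal, of height one, in the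
homogeneous coordinate ring. -/
@[ext]
structure PrimeDivisor (f δ : k[X]) where
  ideal : Ideal (CoordRing K f δ)
  isPrime : ideal.IsPrime
  homogeneous : ∀ (F : MvPolynomial (Fin 6) K) (n : ℕ), toCoord K f δ F ∈ ideal →
    toCoord K f δ (MvPolynomial.homogeneousComponent n F) ∈ ideal
  height_eq_one : ideal.height = 1

/-- Weil divisors: the free abelian group on the prime divisors. -/
abbrev Divisor (f δ : k[X]) : Type v := PrimeDivisor K f δ →₀ ℤ

variable {K}

/-- The order of vanishing of a form `a` along the prime divisor `P`: the length of `A_P / (a)`,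
where `A` is the homogeneous coordinate ring.  (`A_P` is the local ring of the affine cone over
`V_δ` at the generic point of the cone over `P`.  It has the same uniformizers as the local ring of
`V_δ` at `P`, which is its part of degree zero, and forms of degree one outside `P` are units
in it, so this is the multiplicity of `P` in the divisor on `V_δ` cut out by `a`.) -/
def ordForm {f δ : k[X]} (P : PrimeDivisor K f δ) (a : CoordRing K f δ) : ℕ :=
  haveI := P.isPrime
  (Ring.ord (Localization.AtPrime P.ideal)
    (algebraMap (CoordRing K f δ) (Localization.AtPrime P.ideal) a)).toNat

/-- The order of `φ = a / b` along `P`, namely `ord_P a - ord_P b`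
(the value does not depend on the way of writing `φ ≠ 0` as a fraction). -/
def ordFrac {f δ : k[X]} (P : PrimeDivisor K f δ) (φ : FracField K f δ) : ℤ :=
  (ordForm P (IsLocalization.sec (nonZeroDivisors (CoordRing K f δ)) φ).1 : ℤ) -
    ordForm P ((IsLocalization.sec (nonZeroDivisors (CoordRing K f δ)) φ).2 : CoordRing K f δ)

theorem mem_of_ordForm_ne_zero {f δ : k[X]} {P : PrimeDivisor K f δ} {a : CoordRing K f δ}
    (h : ordForm P a ≠ 0) : a ∈ P.ideal := by
  have := P.isPrime
  by_contra ha
  apply h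
  have hu : IsUnit (algebraMap (CoordRing K f δ) (Localization.AtPrime P.ideal) a) :=
    IsLocalization.map_units (Localization.AtPrime P.ideal)
      (⟨a, ha⟩ : P.ideal.primeCompl)
  have h1 := Ring.ord_mul_of_isUnit_left hu (1 : Localization.AtPrime P.ideal)
  rw [mul_one, Ring.ord_one] at h1
  simp only [ordForm, h1, ENat.toNat_zero]

theorem finite_setOf_ordForm_ne_zero {f δ : k[X]} [(surfaceIdeal K f δ).IsPrime]
    {a : CoordRing K f δ} (ha : a ≠ 0) : {P : PrimeDivisor K f δ | ordForm P a ≠ 0}.Finite := by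
  have hfin := (Ideal.span {a}).finite_minimalPrimes_of_isNoetherianRing (CoordRing K f δ)
  refine (hfin.preimage (f := PrimeDivisor.ideal) ?_).subset ?_
  · intro P _ Q _ h
    exact PrimeDivisor.ext h
  · intro P hP
    have := P.isPrime
    have : P.ideal.FiniteHeight := ⟨Or.inr (by rw [P.height_eq_one]; exact ENat.one_ne_top)⟩
    refine Ideal.mem_minimalPrimes_of_height_le
      ((Ideal.span_singleton_le_iff_mem _).2 (mem_of_ordForm_ne_zero hP)) ?_
    rw [P.height_eq_one]
    exact Ideal.one_le_height_span_singleton_of_mem_nonZeroDivisors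
      (mem_nonZeroDivisors_of_ne_zero ha)

theorem finite_support_ordFrac {f δ : k[X]} [(surfaceIdeal K f δ).IsPrime]
    {φ : FracField K f δ} (hφ : φ ≠ 0) :
    (Function.support fun P : PrimeDivisor K f δ => ordFrac P φ).Finite := by
  set s := IsLocalization.sec (nonZeroDivisors (CoordRing K f δ)) φ with hs
  have hspec := IsLocalization.sec_spec (nonZeroDivisors (CoordRing K f δ)) φ
  have h1 : s.1 ≠ 0 := by
    intro h0
    rw [← hs, h0, map_zero] at hspec
    rcases mul_eq_zero.1 hspec with h | h
    · exact hφ h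
    · exact nonZeroDivisors.ne_zero s.2.2
        ((IsFractionRing.injective (CoordRing K f δ) (FracField K f δ)) (h.trans (map_zero _).symm))
  refine ((finite_setOf_ordForm_ne_zero h1).union
    (finite_setOf_ordForm_ne_zero (nonZeroDivisors.ne_zero s.2.2))).subset ?_
  intro P hP
  by_contra hc
  simp only [Set.mem_union, Set.mem_ofPred_eq, not_or, not_not] at hc
  apply hP
  simp only [ordFrac, ← hs, hc.1, hc.2, sub_self]

open Classical in
/-- The divisor of a nonzero rational function on the integral surface `V_δ`
(by convention `0` for the zero function). -/
def divOf {f δ : k[X]} [(surfaceIdeal K f δ).IsPrime] (φ : FracField K f δ) : Divisor K f δ :=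
  if h : φ ≠ 0 then Finsupp.ofSupportFinite (fun P => ordFrac P φ) (finite_support_ordFrac h)
  else 0

/-- `p` is a nonzero linear form, and the divisor of the hyperplane section `p = 0` of `V_δ`
is `D`. -/
structure CutsOut {f δ : k[X]} (p : MvPolynomial (Fin 6) K) (D : Divisor K f δ) : Prop where
  linear : p.IsHomogeneous 1
  ne_zero : p ≠ 0
  ord_eq : ∀ P : PrimeDivisor K f δ, (ordForm P (toCoord K f δ p) : ℤ) = D P

end Surface

section Galois

variable {k : Type u} [Field k] {K : Type v} [Field K] [Algebra k K]

/-- An automorphism of `K` over `k` acting on polynomials through their coefficients. -/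
abbrev actPoly (σ : Gal(K/k)) : MvPolynomial (Fin 6) K ≃+* MvPolynomial (Fin 6) K :=
  MvPolynomial.mapEquiv (Fin 6) (σ : K ≃+* K)

theorem actPoly_quadric (f δ : k[X]) (σ : Gal(K/k)) (j : ℕ) :
    actPoly σ ((quadric f δ j).map (algebraMap k K)) = (quadric f δ j).map (algebraMap k K) := by
  rw [actPoly, MvPolynomial.mapEquiv_apply, MvPolynomial.map_map]
  exact congrArg (fun g => MvPolynomial.map g (quadric f δ j))
    (RingHom.ext fun x => σ.commutes x)

theorem surfaceIdeal_map (f δ : k[X]) (σ : Gal(K/k)) :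
    surfaceIdeal K f δ =
      (surfaceIdeal K f δ).map (actPoly σ : MvPolynomial (Fin 6) K →+* _) := by
  rw [surfaceIdeal, Ideal.map_span]
  congr 1
  ext P
  constructor
  · rintro ⟨j, hj, rfl⟩
    exact ⟨_, ⟨j, hj, rfl⟩, actPoly_quadric f δ σ j⟩
  · rintro ⟨_, ⟨j, hj, rfl⟩, rfl⟩
    exact ⟨j, hj, actPoly_quadric f δ σ j⟩

/-- The action of an automorphism of `K` over `k` on the homogeneous coordinate ring, through the
coefficients of polynomials. -/
def actCoord (f δ : k[X]) (σ : Gal(K/k)) : CoordRing K f δ ≃+* CoordRing K f δ :=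
  Ideal.quotientEquiv _ _ (actPoly σ) (surfaceIdeal_map f δ σ)

theorem actCoord_toCoord (f δ : k[X]) (σ : Gal(K/k)) (F : MvPolynomial (Fin 6) K) :
    actCoord f δ σ (toCoord K f δ F) = toCoord K f δ (actPoly σ F) := rfl

theorem actPoly_homogeneousComponent (σ : Gal(K/k)) (F : MvPolynomial (Fin 6) K) (n : ℕ) :
    actPoly σ (MvPolynomial.homogeneousComponent n F) =
      MvPolynomial.homogeneousComponent n (actPoly σ F) := by
  ext m
  simp only [actPoly, MvPolynomial.mapEquiv_apply, MvPolynomial.coeff_map,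
    MvPolynomial.coeff_homogeneousComponent]
  split_ifs <;> simp

/-- The action of an automorphism of `K` over `k` on prime divisors: the ideal of `σ P` is the image
under `σ` of the ideal of `P`. -/
def PrimeDivisor.act {f δ : k[X]} (σ : Gal(K/k)) (P : PrimeDivisor K f δ) :
    PrimeDivisor K f δ where
  ideal := P.ideal.map (actCoord f δ σ : CoordRing K f δ →+* CoordRing K f δ)
  isPrime := by
    have := P.isPrime
    exact Ideal.map_isPrime_of_equiv (actCoord f δ σ)
  homogeneous F n hF := by
    obtain ⟨G, rfl⟩ := (actPoly σ).surjective F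
    rw [← actPoly_homogeneousComponent, ← actCoord_toCoord]
    rw [← actCoord_toCoord] at hF
    obtain ⟨a, ha, hF⟩ := (Ideal.mem_map_iff_of_surjective _ (actCoord f δ σ).surjective).1 hF
    obtain rfl := (actCoord f δ σ).injective hF
    exact Ideal.mem_map_of_mem _ (P.homogeneous G n ha)
  height_eq_one := (RingEquiv.height_map (actCoord f δ σ) P.ideal).trans P.height_eq_one

/-- The action on divisors, `∑ n_P P ↦ ∑ n_P σ(P)`. -/
def Divisor.act {f δ : k[X]} (σ : Gal(K/k)) (D : Divisor K f δ) : Divisor K f δ :=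
  Finsupp.mapDomain (PrimeDivisor.act σ) D

/-- A divisor is defined over the intermediate field `L` if it is fixed by every automorphism of `K`
over `L`. -/
def Divisor.DefinedOver {f δ : k[X]} (D : Divisor K f δ) (L : IntermediateField k K) : Prop :=
  ∀ τ ∈ L.fixingSubgroup, D.act τ = D

end Galois

section Lines

variable {k : Type u} [Field k] {K : Type v} [Field K] [Algebra k K]

/-- The polynomial `γ_s` of degree at most `5` with `γ_s(r_i) = (-1)^{s_i} / z_i` for all `i`. -/
def gammaPoly (r z : Fin 6 → K) (s : Fin 6 → ZMod 2) : K[X] :=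
  Lagrange.interpolate Finset.univ r fun i => (-1) ^ (s i).val / z i

/-- The coordinate vector `(a_0, …, a_5)` of the class of `γ_s(x) (t x + u)` modulo `f`. -/
def linePoint (f : k[X]) (r z : Fin 6 → K) (s : Fin 6 → ZMod 2) (t u : K) : Fin 6 → K := fun j =>
  ((gammaPoly r z s * (Polynomial.C t * Polynomial.X + Polynomial.C u)) %ₘ
    (f * Polynomial.C f.leadingCoeff⁻¹).map (algebraMap k K)).coeff j

/-- The ideal, in the homogeneous coordinate ring of `V_δ`, of the line `L_s`. -/
def lineIdeal (f δ : k[X]) (r z : Fin 6 → K) (s : Fin 6 → ZMod 2) : Ideal (CoordRing K f δ) :=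
  (MvPolynomial.vanishingIdeal K
    (Set.range fun tu : K × K => linePoint f r z s tu.1 tu.2)).map (toCoord K f δ)

open Classical in
/-- The line `L_s` as a divisor: multiplicity `1` at the prime divisor whose ideal is that of `L_s`,
and `0` elsewhere. -/
def lineDiv (f δ : k[X]) (r z : Fin 6 → K) (s : Fin 6 → ZMod 2) : Divisor K f δ :=
  Finsupp.ofSupportFinite (fun P => if P.ideal = lineIdeal f δ r z s then 1 else 0) <| by
    refine Set.Subsingleton.finite fun P hP Q hQ => PrimeDivisor.ext ?_
    simp only [Function.mem_support, ne_eq, ite_eq_right_iff, one_ne_zero, imp_false,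
      not_not] at hP hQ
    rw [hP, hQ]

/-- The divisor `E_{I,B}`: the sum of the lines `L_s` with `s_{I_j} = B_j` for `j = 0, 1, 2`. -/
def lineSum (f δ : k[X]) (r z : Fin 6 → K) (I : Fin 3 → Fin 6) (B : Fin 3 → ZMod 2) :
    Divisor K f δ :=
  ∑ s : Fin 6 → ZMod 2 with ∀ j, s (I j) = B j, lineDiv f δ r z s

/-- The divisor `E`. -/
def divE (f δ : k[X]) (r z : Fin 6 → K) : Divisor K f δ :=
  (lineDiv f δ r z ![0, 0, 0, 1, 1, 0] + lineDiv f δ r z ![0, 0, 0, 1, 1, 1]) -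
    (lineDiv f δ r z ![0, 0, 1, 0, 0, 0] + lineDiv f δ r z ![0, 0, 1, 0, 0, 1])

/-- The function `h = 1 + p₃/p₄ + q₅/p₄ + p₃/p₅` (in the numbering `1, …, 6`). -/
def hFun {f δ : k[X]} [(surfaceIdeal K f δ).IsPrime] (p q : Fin 6 → MvPolynomial (Fin 6) K) :
    FracField K f δ :=
  let c : MvPolynomial (Fin 6) K → FracField K f δ := fun F =>
    algebraMap (CoordRing K f δ) (FracField K f δ) (toCoord K f δ F)
  1 + c (p 2) / c (p 3) + c (q 4) / c (p 3) + c (p 2) / c (p 4)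

end Lines

section Conditions

variable {k : Type u} [Field k] {K : Type v} [Field K] [Algebra k K]

/-- The automorphism `σ` induces the element `s · π`, `s` in `(ℤ/2)⁶` and `π` in `S₆`: it sends `r_i`
to `r_{π i}` and `z_i` to `± z_{π i}`, with the sign `-1` exactly if `s` has a `1` in the spot `π i`. -/
def Induces (r z : Fin 6 → K) (σ : Gal(K/k)) (s : Fin 6 → ZMod 2) (π : Equiv.Perm (Fin 6)) : Prop :=
  ∀ i, σ (r i) = r (π i) ∧ σ (z i) = (-1) ^ (s (π i)).val * z (π i)

/-- The elements `s · π` of the group `H₉₆`, generated by the sign changes `(0,0,1,0,0,1)`,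
`(0,0,1,1,1,1)` and the permutations `(12)`, `(345)`, `(34)` of `1, …, 6`: the vector `s` has
`s₁ = s₂ = 0` and even weight, and `π` preserves `{1, 2}`, `{3, 4, 5}` and `{6}`. -/
def InH96 (s : Fin 6 → ZMod 2) (π : Equiv.Perm (Fin 6)) : Prop :=
  s 0 = 0 ∧ s 1 = 0 ∧ ∑ i, s i = 0 ∧ (∀ i, π i < 2 ↔ i < 2) ∧ π 5 = 5

/-- Condition 1: for `i` among `3, …, 6` the forms `p_i, q_i` have coefficients in
`k(r₁, z_i, z₆)`, and `(0,0,1,1,1,1)` sends `p_i` to `q_i`. -/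
def Condition1 (k : Type u) [Field k] [Algebra k K] (r z : Fin 6 → K)
    (p q : Fin 6 → MvPolynomial (Fin 6) K) : Prop :=
  ∀ i : Fin 6, 2 ≤ i →
    (∀ m, (p i).coeff m ∈ k⟮r 0, z i, z 5⟯ ∧ (q i).coeff m ∈ k⟮r 0, z i, z 5⟯) ∧
    ∀ σ : Gal(K/k), Induces r z σ ![0, 0, 1, 1, 1, 1] 1 → actPoly σ (p i) = q i

/-- Condition 2: an automorphism inducing `s · π` in `H₉₆` sends `p_i, q_i` to `p_j, q_j`, where
`j = π i`, if `s` has a `0` in the spot `j`, and interchanges them, sending `p_i, q_i` to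
`q_j, p_j`, if `s` has a `1` there. -/
def Condition2 (k : Type u) [Field k] [Algebra k K] (r z : Fin 6 → K)
    (p q : Fin 6 → MvPolynomial (Fin 6) K) : Prop :=
  ∀ (σ : Gal(K/k)) (s : Fin 6 → ZMod 2) (π : Equiv.Perm (Fin 6)), InH96 s π → Induces r z σ s π →
    ∀ i : Fin 6, 2 ≤ i →
      (s (π i) = 0 → actPoly σ (p i) = p (π i) ∧ actPoly σ (q i) = q (π i)) ∧
      (s (π i) = 1 → actPoly σ (p i) = q (π i) ∧ actPoly σ (q i) = p (π i))

/-- Condition 3: `p_i q_i = p_j q_j` on `V_δ` for `i, j` among `3, 4, 5`. -/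
def Condition3 (f δ : k[X]) (p q : Fin 6 → MvPolynomial (Fin 6) K) : Prop :=
  ∀ i ∈ ({2, 3, 4} : Set (Fin 6)), ∀ j ∈ ({2, 3, 4} : Set (Fin 6)),
    toCoord K f δ (p i * q i) = toCoord K f δ (p j * q j)

end Conditions

end KThree

end

noncomputable section

namespace KThree

universe u v

/-! Indices run over 0, …, 5 as in the code. In the coordinates x_i = z_i q(r_i), where q = ∑ a_j
x^j, the equations of V say that x_i² = c(r_i) for one polynomial c of degree at most 2. So the
coordinate ring is K[x_0, x_1, x_2] with square roots of three diagonal ternary quadratic forms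
adjoined. These forms are primes, none dividing another, so each new square root again gives a
domain (`isDomain_tower`, `IsFrame.isPrime`). On L_s one has x_i = (-1)^{s_i} (t r_i + u), which
makes the lines prime divisors and makes the Galois action on them explicit.

Let P_i, Q_i be the classes of p_i, q_i and let N be the common value of P_i Q_i for i = 2, 3, 4.
Clearing denominators gives h P_3 P_4 = G with G = P_2 P_3 + P_2 P_4 + P_3 P_4 + N, symmetric in 2,
3, 4 (`hFun_mul_eq`). On the line (0,0,0,1,1,0) the form P_2 vanishes while P_3 and P_4 do not, and
G restricts to P_3 P_4; hence h ≠ 0. Let ℓ(a,b,c) be the sum of the two lines (0,0,a,b,c,*).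
Counting lines gives E - div h = ℓ(0,0,0) - ℓ(1,1,1) + div N - div G.

An automorphism τ fixing z_5 induces s·π in H₉₆ with s_5 = 0 (`exists_induces`), so s is zero or has
exactly two ones, at i and j among 2, 3, 4. If s = 0, all four terms are fixed. Otherwise N is fixed
and P_i P_j · τG = N G, so div G changes by div N - div P_i - div P_j. That is exactly the change of
ℓ(0,0,0) - ℓ(1,1,1), and the two changes cancel (`IsFrame.act_divE_sub_divOf`).

Orders of vanishing are lengths over one-dimensional Noetherian local domains. They are finite and
additive there, so no regularity of V is needed. -/

theorem _root_.Ring.ord_map_ringEquiv {R S : Type*} [CommRing R] [CommRing S] (e : R ≃+* S)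
    (x : R) : Ring.ord S (e x) = Ring.ord R x := by
  -- The length of R/(x) is the coheight of (x) in the lattice of ideals, which an isomorphism of
  -- lattices preserves.
  rw [Ring.ord, Ring.ord, Module.length_quotient, Module.length_quotient]
  let E : Ideal R ≃o Ideal S :=
    { toFun := Ideal.map e
      invFun := Ideal.comap e
      left_inv := fun I => Ideal.comap_map_of_bijective e e.bijective
      right_inv := fun I => Ideal.map_comap_of_surjective e e.surjective I
      map_rel_iff' := by
        intro I J
        constructor
        · intro h
          have := Ideal.comap_mono (f := e) h
          simpa [Ideal.comap_map_of_bijective e e.bijective] using this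
        · exact fun h => Ideal.map_mono h }
  have h1 : E (Ideal.span {x}) = Ideal.span {e x} := by
    change Ideal.map e _ = _
    rw [Ideal.map_span, Set.image_singleton]
  rw [← h1]
  exact Order.coheight_orderIso E (Ideal.span {x})

theorem _root_.Ring.ord_localization_map {R : Type*} [CommRing R] (e : R ≃+* R) (p q : Ideal R)
    [p.IsPrime] [q.IsPrime] (h : ∀ a, e a ∈ q ↔ a ∈ p) (a : R) :
    Ring.ord (Localization.AtPrime q) (algebraMap R (Localization.AtPrime q) (e a)) =
      Ring.ord (Localization.AtPrime p) (algebraMap R (Localization.AtPrime p) a) := by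
  have hmap : p.primeCompl.map e.toMonoidHom = q.primeCompl := by
    ext b
    obtain ⟨a, rfl⟩ := e.surjective b
    rw [Ideal.mem_primeCompl_iff, h]
    constructor
    · rintro ⟨c, hc, h⟩
      rwa [← e.injective h]
    · intro h
      exact ⟨a, h, rfl⟩
  rw [← Ring.ord_map_ringEquiv (IsLocalization.ringEquivOfRingEquiv (Localization.AtPrime p)
    (Localization.AtPrime q) e hmap), IsLocalization.ringEquivOfRingEquiv_eq]

theorem _root_.Ideal.mem_of_ord_atPrime_eq_zero {A : Type*} [CommRing A] (p : Ideal A)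
    [p.IsPrime] {a : A}
    (h : Ring.ord (Localization.AtPrime p) (algebraMap A (Localization.AtPrime p) a) = 0) :
    a ∉ p := by
  rw [Ring.ord, Module.length_eq_zero_iff, Submodule.Quotient.subsingleton_iff] at h
  exact fun ha => (IsLocalization.AtPrime.isUnit_to_map_iff _ p a).1
    (Ideal.span_singleton_eq_top.1 h) ha

/-! ### Orders at primes of height one -/

section HeightOne

variable {A : Type*} [CommRing A] [IsDomain A] (p : Ideal A) [p.IsPrime]

theorem _root_.Ideal.algebraMap_atPrime_mem_nonZeroDivisors {a : A} (ha : a ≠ 0) :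
    algebraMap A (Localization.AtPrime p) a ∈ nonZeroDivisors (Localization.AtPrime p) :=
  IsLocalization.map_nonZeroDivisors_le p.primeCompl _
    (Submonoid.mem_map_of_mem _ (mem_nonZeroDivisors_of_ne_zero ha))

/-- The local ring is Noetherian of dimension one, so a nonzerodivisor has a quotient of finite
length. Finiteness matters because `ordForm` turns an infinite order into 0. -/
theorem _root_.Ideal.ord_atPrime_ne_top [IsNoetherianRing A] (hp : p.height = 1) {a : A}
    (ha : a ≠ 0) :
    Ring.ord (Localization.AtPrime p) (algebraMap A (Localization.AtPrime p) a) ≠ ⊤ := by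
  have : Ring.KrullDimLE 1 (Localization.AtPrime p) := by
    rw [Ring.krullDimLE_iff,
      IsLocalization.AtPrime.ringKrullDim_eq_height p (Localization.AtPrime p), hp]
    rfl
  have : IsNoetherianRing (Localization.AtPrime p) :=
    IsLocalization.isNoetherianRing p.primeCompl _ inferInstance
  exact Ring.ord_ne_top (p.algebraMap_atPrime_mem_nonZeroDivisors ha)

end HeightOne

/-! ### Divisors of forms and functions, and the Galois action on them -/

section Divisors

variable {k : Type u} [Field k] {K : Type v} [Field K] [Algebra k K] {f δ : k[X]}

theorem PrimeDivisor.mem_act_iff (σ : Gal(K/k)) (P : PrimeDivisor K f δ) (a : CoordRing K f δ) :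
    actCoord f δ σ a ∈ (PrimeDivisor.act σ P).ideal ↔ a ∈ P.ideal := by
  refine ⟨fun h => ?_, fun h => Ideal.mem_map_of_mem _ h⟩
  obtain ⟨b, hb, hba⟩ := (Ideal.mem_map_iff_of_surjective _ (actCoord f δ σ).surjective).1 h
  rwa [← (actCoord f δ σ).injective hba]

theorem ordForm_act (σ : Gal(K/k)) (P : PrimeDivisor K f δ) (a : CoordRing K f δ) :
    ordForm (PrimeDivisor.act σ P) (actCoord f δ σ a) = ordForm P a := by
  have := P.isPrime
  have := (PrimeDivisor.act σ P).isPrime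
  exact congrArg ENat.toNat (Ring.ord_localization_map (actCoord f δ σ) P.ideal
    (PrimeDivisor.act σ P).ideal (P.mem_act_iff σ) a)

theorem PrimeDivisor.act_bijective (σ : Gal(K/k)) :
    Function.Bijective (PrimeDivisor.act (f := f) (δ := δ) σ) := by
  constructor
  · intro P Q h
    ext a
    rw [← P.mem_act_iff σ, h, Q.mem_act_iff σ]
  · intro P
    refine ⟨PrimeDivisor.act σ⁻¹ P, PrimeDivisor.ext ?_⟩
    have hcomp : ∀ a, actCoord f δ σ (actCoord f δ σ⁻¹ a) = a := by
      intro a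
      obtain ⟨F, rfl⟩ := Ideal.Quotient.mk_surjective a
      change toCoord K f δ (actPoly σ (actPoly σ⁻¹ F)) = _
      congr 1
      ext m
      simp only [actPoly, MvPolynomial.mapEquiv_apply, MvPolynomial.coeff_map]
      exact AlgEquiv.apply_symm_apply σ _
    ext a
    constructor
    · intro h
      obtain ⟨b, hb, rfl⟩ := (Ideal.mem_map_iff_of_surjective _ (actCoord f δ σ).surjective).1 h
      obtain ⟨c, hc, rfl⟩ := (Ideal.mem_map_iff_of_surjective _ (actCoord f δ σ⁻¹).surjective).1 hb
      exact (hcomp c).symm ▸ hc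
    · intro h
      rw [← hcomp a]
      exact Ideal.mem_map_of_mem _ (Ideal.mem_map_of_mem _ h)

theorem Divisor.act_apply (σ : Gal(K/k)) (D : Divisor K f δ) (P : PrimeDivisor K f δ) :
    Divisor.act σ D (PrimeDivisor.act σ P) = D P :=
  Finsupp.mapDomain_apply (PrimeDivisor.act_bijective σ).1 D P

theorem Divisor.act_add (σ : Gal(K/k)) (D E : Divisor K f δ) :
    Divisor.act σ (D + E) = Divisor.act σ D + Divisor.act σ E :=
  Finsupp.mapDomain_add

theorem Divisor.act_sub (σ : Gal(K/k)) (D E : Divisor K f δ) :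
    Divisor.act σ (D - E) = Divisor.act σ D - Divisor.act σ E := by
  rw [eq_sub_iff_add_eq, ← Divisor.act_add, sub_add_cancel]

variable [(surfaceIdeal K f δ).IsPrime]

theorem ordForm_mul (P : PrimeDivisor K f δ) {a b : CoordRing K f δ} (ha : a ≠ 0) (hb : b ≠ 0) :
    ordForm P (a * b) = ordForm P a + ordForm P b := by
  have := P.isPrime
  rw [ordForm, map_mul, Ring.ord_mul _ (P.ideal.algebraMap_atPrime_mem_nonZeroDivisors hb),
    ENat.toNat_add (P.ideal.ord_atPrime_ne_top P.height_eq_one ha)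
      (P.ideal.ord_atPrime_ne_top P.height_eq_one hb)]
  rfl

theorem ordForm_ne_zero_iff {P : PrimeDivisor K f δ} {a : CoordRing K f δ} (ha : a ≠ 0) :
    ordForm P a ≠ 0 ↔ a ∈ P.ideal := by
  refine ⟨mem_of_ordForm_ne_zero, fun h h0 => ?_⟩
  have := P.isPrime
  -- `toNat` is 0 both at 0 and at ⊤; the second value is excluded by finiteness.
  rcases ENat.toNat_eq_zero.1 h0 with h1 | h1
  · exact P.ideal.mem_of_ord_atPrime_eq_zero h1 h
  · exact P.ideal.ord_atPrime_ne_top P.height_eq_one ha h1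

open Classical in
/-- The divisor of zeros of a form (by convention `0` for the zero form). -/
def formDiv (a : CoordRing K f δ) : Divisor K f δ :=
  if h : a ≠ 0 then Finsupp.ofSupportFinite (fun P => (ordForm P a : ℤ))
    ((finite_setOf_ordForm_ne_zero h).subset fun P hP => by simpa using hP)
  else 0

theorem formDiv_apply {a : CoordRing K f δ} (ha : a ≠ 0) (P : PrimeDivisor K f δ) :
    formDiv a P = ordForm P a := by
  rw [formDiv, dif_pos ha]
  rfl

theorem formDiv_mul {a b : CoordRing K f δ} (ha : a ≠ 0) (hb : b ≠ 0) :
    formDiv (a * b) = formDiv a + formDiv b := by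
  ext P
  rw [Finsupp.add_apply, formDiv_apply ha, formDiv_apply hb, formDiv_apply (mul_ne_zero ha hb),
    ordForm_mul P ha hb, Nat.cast_add]

/-- `divOf` is computed from one chosen fraction. Cross-multiplying and additivity of orders show
that every other fraction for φ gives the same divisor. -/
theorem divOf_eq_formDiv_sub {φ : FracField K f δ} {a b : CoordRing K f δ} (ha : a ≠ 0)
    (hb : b ≠ 0) (h : φ * algebraMap _ (FracField K f δ) b = algebraMap _ (FracField K f δ) a) :
    divOf φ = formDiv a - formDiv b := by
  have hinj := IsFractionRing.injective (CoordRing K f δ) (FracField K f δ)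
  have hφ : φ ≠ 0 := by
    rintro rfl
    rw [zero_mul] at h
    exact ha (hinj (h.symm.trans (map_zero _).symm))
  have hspec := IsLocalization.sec_spec (nonZeroDivisors (CoordRing K f δ)) φ
  set s := IsLocalization.sec (nonZeroDivisors (CoordRing K f δ)) φ with hs
  have hs2 : (s.2 : CoordRing K f δ) ≠ 0 := nonZeroDivisors.ne_zero s.2.2
  have h1 : s.1 ≠ 0 := by
    intro h0
    rw [h0, map_zero] at hspec
    rcases mul_eq_zero.1 hspec with h | h
    · exact hφ h
    · exact hs2 (hinj (h.trans (map_zero _).symm))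
  have key : s.1 * b = a * s.2 := by
    apply hinj
    rw [map_mul, map_mul, ← hspec, ← h]
    ring
  have key2 := congrArg formDiv key
  rw [formDiv_mul h1 hb, formDiv_mul ha hs2] at key2
  have key3 : divOf φ = formDiv s.1 - formDiv (s.2 : CoordRing K f δ) := by
    ext P
    rw [divOf, dif_pos hφ, Finsupp.sub_apply, formDiv_apply h1, formDiv_apply hs2]
    rfl
  rw [key3, sub_eq_sub_iff_add_eq_add, key2]

theorem Divisor.act_formDiv (σ : Gal(K/k)) (a : CoordRing K f δ) :
    Divisor.act σ (formDiv a) = formDiv (actCoord f δ σ a) := by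
  by_cases ha : a = 0
  · rw [ha, map_zero, formDiv, dif_neg (not_not.2 rfl)]
    exact Finsupp.mapDomain_zero
  ext P
  obtain ⟨P, rfl⟩ := (PrimeDivisor.act_bijective σ).2 P
  rw [Divisor.act_apply, formDiv_apply ha,
    formDiv_apply ((map_ne_zero_iff _ (actCoord f δ σ).injective).2 ha), ordForm_act]

end Divisors

/-! ### Adjoining square roots to a domain -/

section QuadraticTower

/-- `b` is not a square in the field of fractions of the domain `D`, and is not zero. -/
def NotFracSq {D : Type*} [CommRing D] (b : D) : Prop :=
  ∀ x y : D, x ^ 2 = b * y ^ 2 → y = 0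

variable {D : Type*} [CommRing D] [IsDomain D]

open QuadraticAlgebra in
-- The norm re² - a im² is multiplicative, and it vanishes only at 0 because a is not a square.
theorem NotFracSq.isDomain_quadraticAlgebra {a : D} (ha : NotFracSq a) :
    IsDomain (QuadraticAlgebra D a 0) := by
  have hnorm : ∀ u : QuadraticAlgebra D a 0, u.norm = 0 → u = 0 := by
    intro u hu
    rw [QuadraticAlgebra.norm_def] at hu
    have h1 : u.im = 0 := ha u.re u.im (by linear_combination hu)
    have h2 : u.re = 0 := by
      rw [h1] at hu
      exact pow_eq_zero_iff two_ne_zero |>.1 (by linear_combination hu)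
    ext <;> assumption
  have : NoZeroDivisors (QuadraticAlgebra D a 0) := ⟨fun {u v} huv => by
    have h := congrArg QuadraticAlgebra.norm huv
    rw [map_mul, QuadraticAlgebra.norm_zero] at h
    exact (mul_eq_zero.1 h).imp (hnorm u) (hnorm v)⟩
  exact NoZeroDivisors.to_isDomain _

/-- If the square of re + im √a has no √a part, then re or im is zero. So b can become a square
after adjoining √a only if b or ab already was one. -/
theorem NotFracSq.algebraMap_quadraticAlgebra (h2 : (2 : D) ≠ 0) {a b : D} (ha : NotFracSq a)
    (hb : NotFracSq b) (hab : NotFracSq (a * b)) :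
    NotFracSq (algebraMap D (QuadraticAlgebra D a 0) b) := by
  have := ha.isDomain_quadraticAlgebra
  have ha0 : a ≠ 0 := by
    rintro rfl
    exact one_ne_zero (ha 0 1 (by ring))
  intro x y hxy
  set n := y.norm with hn
  -- Multiplying by the squared conjugate of y moves the right-hand side into D.
  have key : (x * star y) ^ 2 = algebraMap D (QuadraticAlgebra D a 0) (b * n ^ 2) := by
    rw [map_mul, map_pow, hn, QuadraticAlgebra.algebraMap_norm_eq_mul_star]
    linear_combination (star y) ^ 2 * hxy
  set w := x * star y
  have hre := congrArg QuadraticAlgebra.re key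
  have him := congrArg QuadraticAlgebra.im key
  rw [pow_two, QuadraticAlgebra.re_mul, QuadraticAlgebra.algebraMap_re] at hre
  rw [pow_two, QuadraticAlgebra.im_mul, QuadraticAlgebra.algebraMap_im] at him
  have hprod : w.re * w.im = 0 := by
    apply (mul_eq_zero.1 (?_ : (2 : D) * (w.re * w.im) = 0)).resolve_left h2
    linear_combination him
  have hn0 : n = 0 := by
    rcases mul_eq_zero.1 hprod with h | h
    · rw [h] at hre
      exact hab (a * w.im) n (by linear_combination a * hre)
    · rw [h] at hre
      exact hb w.re n (by linear_combination hre)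
  have h0 : y * star y = 0 := by
    rw [← QuadraticAlgebra.algebraMap_norm_eq_mul_star, ← hn, hn0, map_zero]
  rcases mul_eq_zero.1 h0 with h | h
  · exact h
  · simpa using h

/-- The multiplicity of p is even in x² and odd in p m y². -/
theorem _root_.Prime.notFracSq_mul [IsNoetherianRing D] {p m : D} (hp : Prime p)
    (hm : ¬ p ∣ m) : NotFracSq (p * m) := by
  intro x y hxy
  by_contra hy
  have hm0 : m ≠ 0 := fun h => hm (h ▸ dvd_zero p)
  have hx : x ≠ 0 := by
    rintro rfl
    rw [zero_pow two_ne_zero] at hxy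
    exact mul_ne_zero (mul_ne_zero hp.ne_zero hm0) (pow_ne_zero 2 hy) hxy.symm
  have hfin : ∀ {t : D}, t ≠ 0 → FiniteMultiplicity p t := fun ht =>
    FiniteMultiplicity.of_not_isUnit hp.not_isUnit ht
  have h := congrArg (multiplicity p) hxy
  rw [mul_assoc, multiplicity_mul hp (hfin (mul_ne_zero hp.ne_zero (mul_ne_zero hm0 (pow_ne_zero 2 hy)))),
    multiplicity_mul hp (hfin (mul_ne_zero hm0 (pow_ne_zero 2 hy))),
    (hfin hx).multiplicity_pow hp, (hfin hy).multiplicity_pow hp, multiplicity_self,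
    multiplicity_eq_zero.2 hm] at h
  omega

/-- The ring obtained from `D` by adjoining square roots of `a`, `b` and `c`. -/
abbrev Tower (a b c : D) : Type _ :=
  QuadraticAlgebra (QuadraticAlgebra (QuadraticAlgebra D a 0)
    (algebraMap D (QuadraticAlgebra D a 0) b) 0)
    (algebraMap (QuadraticAlgebra D a 0) (QuadraticAlgebra (QuadraticAlgebra D a 0)
      (algebraMap D (QuadraticAlgebra D a 0) b) 0) (algebraMap D (QuadraticAlgebra D a 0) c)) 0

/-- That c stays a non-square after adjoining √a and √b comes down to c, ac, bc and abc being
non-squares over D. Each of these has a prime factor of multiplicity one. -/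
theorem isDomain_tower [IsNoetherianRing D] (h2 : (2 : D) ≠ 0) {a b c : D} (ha : Prime a)
    (hb : Prime b) (hc : Prime c) (hab : ¬ a ∣ b) (hac : ¬ a ∣ c) (hbc : ¬ b ∣ c) :
    IsDomain (Tower a b c) := by
  have one : ∀ {p : D}, Prime p → NotFracSq p := fun {p} hp => by
    rw [← mul_one p]
    exact hp.notFracSq_mul fun h => hp.not_isUnit (isUnit_of_dvd_one h)
  have h1 := (one ha).isDomain_quadraticAlgebra
  have hB : NotFracSq (algebraMap D (QuadraticAlgebra D a 0) b) :=
    (one ha).algebraMap_quadraticAlgebra h2 (one hb) (ha.notFracSq_mul hab)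
  have h1' := hB.isDomain_quadraticAlgebra
  have hC : NotFracSq (algebraMap D (QuadraticAlgebra D a 0) c) :=
    (one ha).algebraMap_quadraticAlgebra h2 (one hc) (ha.notFracSq_mul hac)
  have hBC : NotFracSq (algebraMap D (QuadraticAlgebra D a 0) (b * c)) :=
    (one ha).algebraMap_quadraticAlgebra h2 (hb.notFracSq_mul hbc)
      (ha.notFracSq_mul fun h => (ha.dvd_or_dvd h).elim hab hac)
  rw [map_mul] at hBC
  refine (hB.algebraMap_quadraticAlgebra ?_ hC hBC).isDomain_quadraticAlgebra
  rw [← map_ofNat (algebraMap D (QuadraticAlgebra D a 0)) 2]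
  exact fun h => h2 (QuadraticAlgebra.algebraMap_injective (h.trans (map_zero _).symm))

end QuadraticTower

/-! ### Diagonal ternary quadratic forms -/

section DiagonalForms

variable {F : Type*} [Field F] [IsAlgClosed F]

/-- The diagonal ternary quadratic form with coefficients `a`. -/
def diagForm (a : Fin 3 → F) : MvPolynomial (Fin 3) F :=
  ∑ i, MvPolynomial.C (a i) * MvPolynomial.X i ^ 2

theorem prime_linear {F : Type*} [Field F] {s t : F} (hs : s ≠ 0) :
    Prime (MvPolynomial.C s * MvPolynomial.X 0 + MvPolynomial.C t * MvPolynomial.X 1 :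
      MvPolynomial (Fin 2) F) := by
  have hc : MvPolynomial.coeff (Finsupp.single 0 1)
      (MvPolynomial.C s * MvPolynomial.X 0 + MvPolynomial.C t * MvPolynomial.X 1 :
      MvPolynomial (Fin 2) F) = s := by
    have : (Finsupp.single (1 : Fin 2) 1 : Fin 2 →₀ ℕ) ≠ Finsupp.single 0 1 := fun h =>
      one_ne_zero ((Finsupp.single_left_inj one_ne_zero).1 h)
    simp [MvPolynomial.coeff_C_mul, MvPolynomial.coeff_X, this]
  have hh : (MvPolynomial.C s * MvPolynomial.X 0 + MvPolynomial.C t * MvPolynomial.X 1 :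
      MvPolynomial (Fin 2) F).IsHomogeneous 1 :=
    ((MvPolynomial.isHomogeneous_X F 0).C_mul s).add ((MvPolynomial.isHomogeneous_X F 1).C_mul t)
  have h0 : (MvPolynomial.C s * MvPolynomial.X 0 + MvPolynomial.C t * MvPolynomial.X 1 :
      MvPolynomial (Fin 2) F) ≠ 0 := by
    intro h
    rw [h, MvPolynomial.coeff_zero] at hc
    exact hs hc.symm
  refine (MvPolynomial.irreducible_of_totalDegree_eq_one (hh.totalDegree h0) ?_).prime
  intro x hx
  have := hx (Finsupp.single 0 1)
  rw [hc] at this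
  exact isUnit_of_dvd_unit this hs.isUnit

/-- Eisenstein's criterion in the variable X 0. The other two terms form a binary form l m, a
product of linear forms that are not proportional since 2 ≠ 0, and l serves as the Eisenstein prime.
-/
theorem prime_diagForm (h2 : (2 : F) ≠ 0) {a : Fin 3 → F} (ha : ∀ i, a i ≠ 0) :
    Prime (diagForm a) := by
  obtain ⟨s, hs⟩ := IsAlgClosed.exists_pow_nat_eq (a 1) two_pos
  obtain ⟨t, ht⟩ := IsAlgClosed.exists_pow_nat_eq (-(a 2)) two_pos
  have hs0 : s ≠ 0 := by
    rintro rfl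
    exact ha 1 (by rw [← hs]; ring)
  have ht0 : t ≠ 0 := by
    rintro rfl
    exact ha 2 (by rw [← neg_eq_zero, ← ht]; ring)
  rw [← MulEquiv.prime_iff (MvPolynomial.finSuccEquiv F 2)]
  set l : MvPolynomial (Fin 2) F :=
    MvPolynomial.C s * MvPolynomial.X 0 + MvPolynomial.C t * MvPolynomial.X 1 with hl
  set m : MvPolynomial (Fin 2) F :=
    MvPolynomial.C s * MvPolynomial.X 0 + MvPolynomial.C (-t) * MvPolynomial.X 1 with hm
  have hform : MvPolynomial.finSuccEquiv F 2 (diagForm a) =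
      Polynomial.C (MvPolynomial.C (a 0)) * Polynomial.X ^ 2 + Polynomial.C (l * m) := by
    have hlm : l * m = MvPolynomial.C (a 1) * MvPolynomial.X 0 ^ 2 +
        MvPolynomial.C (a 2) * MvPolynomial.X 1 ^ 2 := by
      rw [hl, hm, ← hs, ← neg_neg (a 2), ← ht]
      simp only [map_neg, map_pow]
      ring
    have hC : ∀ x : F, MvPolynomial.finSuccEquiv F 2 (MvPolynomial.C x) =
        Polynomial.C (MvPolynomial.C x) := fun x => by simp [MvPolynomial.finSuccEquiv_apply]
    have h1 : MvPolynomial.finSuccEquiv F 2 (MvPolynomial.X 1) =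
        Polynomial.C (MvPolynomial.X 0) := MvPolynomial.finSuccEquiv_X_succ (j := 0)
    have h2 : MvPolynomial.finSuccEquiv F 2 (MvPolynomial.X 2) =
        Polynomial.C (MvPolynomial.X 1) := MvPolynomial.finSuccEquiv_X_succ (j := 1)
    rw [hlm, diagForm, Fin.sum_univ_three]
    simp only [map_add, map_mul, map_pow, hC, h1, h2, MvPolynomial.finSuccEquiv_X_zero]
    ring
  rw [hform]
  have hp : Prime l := prime_linear hs0
  have hA : (MvPolynomial.C (a 0) : MvPolynomial (Fin 2) F) ≠ 0 := by simpa using ha 0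
  have hu : IsUnit (MvPolynomial.C (a 0) : MvPolynomial (Fin 2) F) :=
    (ha 0).isUnit.map MvPolynomial.C
  set g : (MvPolynomial (Fin 2) F)[X] :=
    Polynomial.C (MvPolynomial.C (a 0)) * Polynomial.X ^ 2 + Polynomial.C (l * m) with hg
  have hdeg : g.degree = 2 := by
    have := Polynomial.degree_quadratic (b := 0) (c := l * m) hA
    simpa [hg] using this
  have hlc : g.leadingCoeff = MvPolynomial.C (a 0) := by
    have := Polynomial.leadingCoeff_quadratic (b := 0) (c := l * m) hA
    simpa [hg] using this
  have hprime : (Ideal.span {l}).IsPrime := (Ideal.span_singleton_prime hp.ne_zero).2 hp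
  have hml : ¬ l ∣ m := by
    rintro ⟨q, hq⟩
    -- The point (t, -s) is a zero of l, and m takes the value 2 s t there.
    have := congrArg (MvPolynomial.eval ![t, -s]) hq
    simp [hl, hm] at this
    have h4 : (2 : F) * s * t = 0 := by
      linear_combination this + (MvPolynomial.eval ![t, -s] q) * mul_comm s t
    exact mul_ne_zero (mul_ne_zero h2 hs0) ht0 h4
  refine (Polynomial.irreducible_of_eisenstein_criterion hprime ?_ ?_ ?_ ?_ ?_).prime
  · rw [hlc, Ideal.mem_span_singleton]
    exact fun h => hp.not_isUnit (isUnit_of_dvd_unit h hu)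
  · intro n hn
    rw [hdeg] at hn
    have hn : n < 2 := by exact_mod_cast hn
    rw [Ideal.mem_span_singleton]
    interval_cases n
    · simp [hg]
    · simp [hg, Polynomial.coeff_X_pow]
  · rw [hdeg]
    decide
  · rw [Ideal.span_singleton_pow, Ideal.mem_span_singleton, pow_two]
    have : g.coeff 0 = l * m := by simp [hg]
    rw [this, mul_dvd_mul_iff_left hp.ne_zero]
    exact hml
  · intro r hr
    have := (Polynomial.C_dvd_iff_dvd_coeff r g).1 hr 2
    have h3 : g.coeff 2 = MvPolynomial.C (a 0) := by simp [hg]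
    rw [h3] at this
    exact isUnit_of_dvd_unit this hu

/-- With s² = a 1 and t² = -a 0, the point (s, t, 0) is a zero of the first form, whereas the second
takes the value a 1 * b 0 - a 0 * b 1 there. -/
theorem not_diagForm_dvd {a b : Fin 3 → F} (h : a 0 * b 1 ≠ a 1 * b 0) :
    ¬ diagForm a ∣ diagForm b := by
  rintro ⟨q, hq⟩
  obtain ⟨s, hs⟩ := IsAlgClosed.exists_pow_nat_eq (a 1) two_pos
  obtain ⟨t, ht⟩ := IsAlgClosed.exists_pow_nat_eq (-(a 0)) two_pos
  have := congrArg (MvPolynomial.eval ![s, t, 0]) hq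
  simp [diagForm, Fin.sum_univ_three, hs, ht] at this
  apply h
  linear_combination -this - (MvPolynomial.eval ![s, t, 0] q) * mul_comm (a 0) (a 1)

end DiagonalForms

/-! ### Diagonal coordinates on V -/

section Frame

variable {k : Type u} [Field k] {K : Type v} [Field K] [Algebra k K]

/-- `r` lists the six distinct roots of `f` in `K`, and `z` square roots of the values of `δ` at
these roots, which are nonzero. -/
structure IsFrame (f δ : k[X]) (r z : Fin 6 → K) : Prop where
  injective : Function.Injective r
  ne_zero : f ≠ 0
  map_eq : (f * Polynomial.C f.leadingCoeff⁻¹).map (algebraMap k K) =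
    ∏ i, (Polynomial.X - Polynomial.C (r i))
  sq_eq : ∀ i, z i ^ 2 = Polynomial.aeval (r i) δ
  z_ne_zero : ∀ i, z i ≠ 0

/-- The coefficient of `x ^ j` in the `i`-th Lagrange basis polynomial at the nodes `r`. -/
def lagCoeff (r : Fin 6 → K) (i j : Fin 6) : K :=
  (Lagrange.basis Finset.univ r i).coeff j

/-- The coefficients of the Lagrange basis form the inverse of the Vandermonde matrix; this and the
next lemma are the two orders of multiplication. -/
theorem sum_lagCoeff_mul_pow_left {r : Fin 6 → K} (hr : Function.Injective r) (j m : Fin 6) :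
    ∑ i, lagCoeff r i j * r i ^ (m : ℕ) = if j = m then 1 else 0 := by
  have h := Lagrange.eq_interpolate (s := Finset.univ) (v := r) (f := Polynomial.X ^ (m : ℕ))
    hr.injOn (by
      rw [Polynomial.degree_X_pow]
      exact_mod_cast m.2)
  have h2 := congrArg (fun g => Polynomial.coeff g (j : ℕ)) h
  simp only [Lagrange.interpolate_apply, Polynomial.finsetSum_coeff, Polynomial.eval_pow,
    Polynomial.eval_X, Polynomial.coeff_C_mul, Polynomial.coeff_X_pow] at h2
  simp only [lagCoeff, Fin.ext_iff]
  rw [h2]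
  exact Finset.sum_congr rfl fun i _ => mul_comm _ _

theorem sum_lagCoeff_mul_pow_right {r : Fin 6 → K} (hr : Function.Injective r) (i l : Fin 6) :
    ∑ j, lagCoeff r i j * r l ^ (j : ℕ) = if i = l then 1 else 0 := by
  have hdeg : (Lagrange.basis Finset.univ r i).natDegree < 6 := by
    rw [Lagrange.natDegree_basis hr.injOn (Finset.mem_univ i)]
    simp
  have h := Polynomial.eval_eq_sum_range' hdeg (r l)
  rw [← Fin.sum_univ_eq_sum_range
    (fun j => (Lagrange.basis Finset.univ r i).coeff j * r l ^ j)] at h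
  simp only [lagCoeff]
  rw [← h]
  split_ifs with hil
  · rw [hil, Lagrange.eval_basis_self hr.injOn (Finset.mem_univ l)]
  · exact Lagrange.eval_basis_of_ne hil (Finset.mem_univ l)

/-- A polynomial of degree at most five is determined by its values at the nodes. -/
theorem sum_lagCoeff_eval {r : Fin 6 → K} (hr : Function.Injective r) {B : Type*} [CommRing B]
    (κ : K →+* B) (c : Fin 6 → B) (j : Fin 6) :
    ∑ i, κ (lagCoeff r i j) * ∑ m : Fin 6, c m * κ (r i) ^ (m : ℕ) = c j := by
  have h : ∀ m, ∑ i, κ (lagCoeff r i j) * (c m * κ (r i) ^ (m : ℕ)) =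
      if j = m then c m else 0 := by
    intro m
    have := congrArg κ (sum_lagCoeff_mul_pow_left hr j m)
    rw [map_sum] at this
    calc _ = c m * ∑ i, κ (lagCoeff r i j * r i ^ (m : ℕ)) := by
          rw [Finset.mul_sum]
          exact Finset.sum_congr rfl fun i _ => by rw [map_mul, map_pow]; ring
      _ = _ := by rw [this]; split_ifs <;> simp
  simp_rw [Finset.mul_sum]
  rw [Finset.sum_comm]
  simp_rw [h]
  simp

/-- The linear form in `a_0, …, a_5` giving `z_i` times the value at `r_i` of `∑ a_j x ^ j`. -/
def nodeForm (r z : Fin 6 → K) (i : Fin 6) : MvPolynomial (Fin 6) K :=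
  MvPolynomial.C (z i) * ∑ j : Fin 6, MvPolynomial.X j * MvPolynomial.C (r i) ^ (j : ℕ)

variable {f δ : k[X]} {r z : Fin 6 → K}

theorem IsFrame.X_eq (h : IsFrame f δ r z) (j : Fin 6) :
    (MvPolynomial.X j : MvPolynomial (Fin 6) K) =
      ∑ i, MvPolynomial.C (lagCoeff r i j / z i) * nodeForm r z i := by
  rw [← sum_lagCoeff_eval h.injective MvPolynomial.C (fun j => MvPolynomial.X j) j]
  refine Finset.sum_congr rfl fun i _ => ?_
  rw [nodeForm, ← mul_assoc, ← map_mul, div_mul_cancel₀ _ (h.z_ne_zero i)]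

theorem IsFrame.monic (h : IsFrame f δ r z) : (f * Polynomial.C f.leadingCoeff⁻¹).Monic :=
  Polynomial.monic_mul_leadingCoeff_inv h.ne_zero

theorem IsFrame.natDegree (h : IsFrame f δ r z) :
    (f * Polynomial.C f.leadingCoeff⁻¹).natDegree = 6 := by
  rw [← h.monic.natDegree_map (algebraMap k K), h.map_eq,
    Polynomial.natDegree_prod_of_monic _ _ fun i _ => Polynomial.monic_X_sub_C _]
  simp

theorem IsFrame.eval_eq_zero (h : IsFrame f δ r z) (i : Fin 6) :
    (f * Polynomial.C f.leadingCoeff⁻¹).eval₂ (algebraMap k K) (r i) = 0 := by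
  rw [← Polynomial.eval_map, h.map_eq, Polynomial.eval_prod]
  exact Finset.prod_eq_zero (Finset.mem_univ i) (by simp)

/-- Reduction modulo f does not change values at the roots of f, and δ(r_i) = z_i². -/
theorem IsFrame.sum_quadric (h : IsFrame f δ r z) (i : Fin 6) :
    ∑ j : Fin 6, (quadric f δ j).map (algebraMap k K) * MvPolynomial.C (r i) ^ (j : ℕ) =
      nodeForm r z i ^ 2 := by
  set g : (MvPolynomial (Fin 6) k)[X] :=
    (f * Polynomial.C f.leadingCoeff⁻¹).map MvPolynomial.C with hg
  have hgm : g.Monic := h.monic.map _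
  have hgd : g.natDegree = 6 := by rw [hg, h.monic.natDegree_map, h.natDegree]
  set P : (MvPolynomial (Fin 6) k)[X] := δ.map MvPolynomial.C *
    (∑ i : Fin 6, Polynomial.C (MvPolynomial.X i) * Polynomial.X ^ (i : ℕ)) ^ 2 with hP
  let φ : MvPolynomial (Fin 6) k →+* MvPolynomial (Fin 6) K := MvPolynomial.map (algebraMap k K)
  have hφC : φ.comp MvPolynomial.C = (MvPolynomial.C (σ := Fin 6)).comp (algebraMap k K) := by
    ext x
    simp [φ]
  have hroot : g.eval₂ φ (MvPolynomial.C (r i)) = 0 := by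
    rw [hg, Polynomial.eval₂_map, hφC, ← Polynomial.hom_eval₂, h.eval_eq_zero, map_zero]
  have hlt : (P %ₘ g).natDegree < 6 := by
    refine (Polynomial.natDegree_modByMonic_lt P hgm fun h1 => ?_).trans_eq hgd
    rw [h1, Polynomial.natDegree_one] at hgd
    omega
  have key := Polynomial.eval₂_modByMonic_eq_self_of_root (p := P) hroot
  rw [Polynomial.eval₂_eq_sum_range' φ hlt, ← Fin.sum_univ_eq_sum_range
    (fun j => φ ((P %ₘ g).coeff j) * MvPolynomial.C (r i) ^ j)] at key
  refine key.trans ?_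
  rw [hP, Polynomial.eval₂_mul, Polynomial.eval₂_map, hφC, ← Polynomial.hom_eval₂,
    Polynomial.eval₂_pow, Polynomial.eval₂_finsetSum, nodeForm, mul_pow, ← map_pow, h.sq_eq i]
  congr 2
  refine Finset.sum_congr rfl fun j _ => ?_
  simp [φ]

theorem IsFrame.quadric_eq (h : IsFrame f δ r z) (j : Fin 6) :
    (quadric f δ j).map (algebraMap k K) =
      ∑ i, MvPolynomial.C (lagCoeff r i j) * nodeForm r z i ^ 2 := by
  rw [← sum_lagCoeff_eval h.injective MvPolynomial.C
    (fun j : Fin 6 => (quadric f δ j).map (algebraMap k K)) j]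
  exact Finset.sum_congr rfl fun i _ => by rw [h.sum_quadric]

/-- The remainder of δ q² takes the values x_i² at the nodes, and V asks that its coefficients of
degrees 3, 4, 5 vanish. This describes the B-valued points of the cone over V without the forms C_j.
-/
theorem IsFrame.surfaceIdeal_le_ker_iff (h : IsFrame f δ r z) {B : Type*} [CommRing B]
    (θ : MvPolynomial (Fin 6) K →+* B) :
    surfaceIdeal K f δ ≤ RingHom.ker θ ↔ ∃ c : Fin 3 → B, ∀ i, θ (nodeForm r z i) ^ 2 =
      c 0 + c 1 * θ (MvPolynomial.C (r i)) + c 2 * θ (MvPolynomial.C (r i)) ^ 2 := by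
  rw [surfaceIdeal, Ideal.span_le]
  constructor
  · intro hI
    have hz : ∀ j ∈ ({3, 4, 5} : Set ℕ), θ ((quadric f δ j).map (algebraMap k K)) = 0 :=
      fun j hj => hI ⟨j, hj, rfl⟩
    refine ⟨fun j => θ ((quadric f δ j).map (algebraMap k K)), fun i => ?_⟩
    rw [← map_pow, ← h.sum_quadric i, map_sum, Fin.sum_univ_six]
    simp only [map_mul, map_pow]
    have h3 := hz 3 (by simp)
    have h4 := hz 4 (by simp)
    have h5 := hz 5 (by simp)
    change _ + _ + _ + θ ((quadric f δ 3).map (algebraMap k K)) * _ +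
      θ ((quadric f δ 4).map (algebraMap k K)) * _ +
      θ ((quadric f δ 5).map (algebraMap k K)) * _ = _
    rw [h3, h4, h5]
    simp
  · rintro ⟨c, hc⟩
    let d : Fin 6 → B := ![c 0, c 1, c 2, 0, 0, 0]
    have hd : ∀ i, ∑ m : Fin 6, d m * (θ.comp MvPolynomial.C) (r i) ^ (m : ℕ) =
        θ (nodeForm r z i) ^ 2 := by
      intro i
      rw [hc i, Fin.sum_univ_six]
      simp [d]
    have key : ∀ j, θ ((quadric f δ (j : Fin 6)).map (algebraMap k K)) = d j := by
      intro j
      rw [h.quadric_eq, map_sum, ← sum_lagCoeff_eval h.injective (θ.comp MvPolynomial.C) d j]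
      refine Finset.sum_congr rfl fun i _ => ?_
      rw [hd, map_mul, map_pow]
      rfl
    rintro _ ⟨j, hj, rfl⟩
    rcases hj with rfl | rfl | rfl
    · exact key 3
    · exact key 4
    · exact key 5

theorem nodeForm_mem_idealOfVars (r z : Fin 6 → K) (i : Fin 6) :
    nodeForm r z i ∈ MvPolynomial.idealOfVars (Fin 6) K :=
  Ideal.mul_mem_left _ _ <| sum_mem fun j _ => Ideal.mul_mem_right _ _ <|
    Ideal.subset_span ⟨j, rfl⟩

/-- Since the equations are quadratic, no nonzero linear form vanishes on V. -/
theorem IsFrame.surfaceIdeal_le (h : IsFrame f δ r z) :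
    surfaceIdeal K f δ ≤ MvPolynomial.idealOfVars (Fin 6) K ^ 2 := by
  have key : ∀ j : Fin 6, (quadric f δ j).map (algebraMap k K) ∈
      MvPolynomial.idealOfVars (Fin 6) K ^ 2 := fun j => by
    rw [h.quadric_eq]
    exact sum_mem fun i _ => Ideal.mul_mem_left _ _ <|
      Ideal.pow_mem_pow (nodeForm_mem_idealOfVars r z i) 2
  rw [surfaceIdeal, Ideal.span_le]
  rintro _ ⟨j, hj, rfl⟩
  rcases hj with rfl | rfl | rfl
  · exact key 3
  · exact key 4
  · exact key 5

theorem IsFrame.toCoord_ne_zero (h : IsFrame f δ r z) {p : MvPolynomial (Fin 6) K}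
    (hp : p.IsHomogeneous 1) (h0 : p ≠ 0) : toCoord K f δ p ≠ 0 := by
  intro hp0
  have hmem := h.surfaceIdeal_le (Ideal.Quotient.eq_zero_iff_mem.1 hp0)
  rw [MvPolynomial.mem_pow_idealOfVars_iff'] at hmem
  apply h0
  ext m
  by_contra hm
  have := hp hm
  refine hm (hmem m ?_)
  rw [Finsupp.degree_eq_weight_one]
  exact this.trans_lt one_lt_two

end Frame

/-- Hides the iterated quadratic algebra behind its mapping property: a map out of it can be
prescribed on D together with the three square roots. -/
theorem exists_tower {D : Type v} [CommRing D] [IsDomain D] [IsNoetherianRing D]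
    (h2 : (2 : D) ≠ 0) {a b c : D} (ha : Prime a) (hb : Prime b) (hc : Prime c)
    (hab : ¬ a ∣ b) (hac : ¬ a ∣ c) (hbc : ¬ b ∣ c) :
    ∃ (B : Type v) (_ : CommRing B) (_ : IsDomain B) (ι : D →+* B) (u v w : B),
      u ^ 2 = ι a ∧ v ^ 2 = ι b ∧ w ^ 2 = ι c ∧
      ∀ {S : Type v} [CommRing S] (φ : D →+* S) (u' v' w' : S), u' ^ 2 = φ a → v' ^ 2 = φ b →
        w' ^ 2 = φ c → ∃ ψ : B →+* S, (∀ d, ψ (ι d) = φ d) ∧ ψ u = u' ∧ ψ v = v' ∧ ψ w = w' := by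
  have step : ∀ (E : Type v) [CommRing E] (e : E), ∃ ω : QuadraticAlgebra E e 0,
      ω ^ 2 = algebraMap _ _ e ∧ ∀ {S : Type v} [CommRing S] (φ : E →+* S) (x : S),
        x ^ 2 = φ e → ∃ ψ : QuadraticAlgebra E e 0 →+* S,
          (∀ d, ψ (algebraMap _ _ d) = φ d) ∧ ψ ω = x := by
    intro E _ e
    refine ⟨QuadraticAlgebra.omega, ?_, ?_⟩
    · rw [pow_two, QuadraticAlgebra.omega_mul_omega_eq_algebraMap, map_zero, zero_mul, add_zero]
    · intro S _ φ x hx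
      let := φ.toAlgebra
      have hx' : x * x = e • (1 : S) + (0 : E) • x := by
        rw [← pow_two, hx, zero_smul, add_zero, Algebra.smul_def, mul_one]
        rfl
      refine ⟨(QuadraticAlgebra.lift ⟨x, hx'⟩ : QuadraticAlgebra E e 0 →ₐ[E] S).toRingHom,
        fun d => AlgHom.commutes _ d, ?_⟩
      change (QuadraticAlgebra.lift ⟨x, hx'⟩ : QuadraticAlgebra E e 0 →ₐ[E] S)
        QuadraticAlgebra.omega = x
      simp
  obtain ⟨u, hu, hU⟩ := step D a
  obtain ⟨v, hv, hV⟩ := step _ (algebraMap D (QuadraticAlgebra D a 0) b)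
  obtain ⟨w, hw, hW⟩ := step _ (algebraMap (QuadraticAlgebra D a 0) (QuadraticAlgebra
    (QuadraticAlgebra D a 0) (algebraMap D (QuadraticAlgebra D a 0) b) 0)
      (algebraMap D (QuadraticAlgebra D a 0) c))
  let i₁ := algebraMap D (QuadraticAlgebra D a 0)
  let i₂ := algebraMap (QuadraticAlgebra D a 0) (QuadraticAlgebra (QuadraticAlgebra D a 0) (i₁ b) 0)
  let i₃ := algebraMap (QuadraticAlgebra (QuadraticAlgebra D a 0) (i₁ b) 0) (Tower a b c)
  refine ⟨Tower a b c, inferInstance, isDomain_tower h2 ha hb hc hab hac hbc,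
    i₃.comp (i₂.comp i₁), i₃ (i₂ u), i₃ v, w, ?_, ?_, hw, ?_⟩
  · rw [← map_pow, ← map_pow, hu]
    rfl
  · rw [← map_pow, hv]
    rfl
  · intro S _ φ u' v' w' hu' hv' hw'
    obtain ⟨ψ₁, h1, h1'⟩ := hU φ u' hu'
    obtain ⟨ψ₂, h2, h2'⟩ := hV ψ₁ v' (by rw [h1, hv'])
    obtain ⟨ψ₃, h3, h3'⟩ := hW ψ₂ w' (by rw [h2, h1, hw'])
    exact ⟨ψ₃, fun d => by rw [← h1, ← h2, ← h3]; rfl, by rw [← h1', ← h2, ← h3],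
      by rw [← h2', ← h3], h3'⟩

/-! ### Interpolation at the first three nodes -/

section Coefficients

variable {K : Type v} [Field K]

/-- The values at `t` of the Lagrange basis polynomials at the nodes `r 0`, `r 1`, `r 2`. -/
def quadCoef (r : Fin 6 → K) (t : K) : Fin 3 → K :=
  ![(t - r 1) * (t - r 2) / ((r 0 - r 1) * (r 0 - r 2)),
    (t - r 0) * (t - r 2) / ((r 1 - r 0) * (r 1 - r 2)),
    (t - r 0) * (t - r 1) / ((r 2 - r 0) * (r 2 - r 1))]

variable {r : Fin 6 → K}

theorem quadCoef_ne_zero (hr : Function.Injective r) {i : Fin 6} (hi : 3 ≤ i) (j : Fin 3) :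
    quadCoef r (r i) j ≠ 0 := by
  have h : ∀ a b : Fin 6, a ≠ b → r a - r b ≠ 0 := fun a b hab => sub_ne_zero.2 (hr.ne hab)
  have h0 := h i 0 (by rintro rfl; exact absurd hi (by decide))
  have h1 := h i 1 (by rintro rfl; exact absurd hi (by decide))
  have h2 := h i 2 (by rintro rfl; exact absurd hi (by decide))
  have h01 := h 0 1 (by decide)
  have h02 := h 0 2 (by decide)
  have h12 := h 1 2 (by decide)
  have h10 := h 1 0 (by decide)
  have h20 := h 2 0 (by decide)
  have h21 := h 2 1 (by decide)
  fin_cases j <;> simp [quadCoef, h0, h1, h2, h01, h02, h12, h10, h20, h21]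

/-- The minor is a product of differences of nodes, up to a nonzero factor. It separates the three
quadratic forms through `not_diagForm_dvd`. -/
theorem quadCoef_minor (hr : Function.Injective r) {i l : Fin 6} (hi : 3 ≤ i) (hl : 3 ≤ l)
    (hil : i ≠ l) : quadCoef r (r i) 0 * quadCoef r (r l) 1 ≠
      quadCoef r (r i) 1 * quadCoef r (r l) 0 := by
  have h : ∀ a b : Fin 6, a ≠ b → r a - r b ≠ 0 := fun a b hab => sub_ne_zero.2 (hr.ne hab)
  have h2 := h i 2 (by rintro rfl; exact absurd hi (by decide))
  have h2' := h l 2 (by rintro rfl; exact absurd hl (by decide))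
  have h01 := h 0 1 (by decide)
  have h02 := h 0 2 (by decide)
  have h12 := h 1 2 (by decide)
  have h10 := h 1 0 (by decide)
  have hil := h l i hil.symm
  rw [← sub_ne_zero]
  have : quadCoef r (r i) 0 * quadCoef r (r l) 1 - quadCoef r (r i) 1 * quadCoef r (r l) 0 =
      (r i - r 2) * (r l - r 2) * (r l - r i) /
        ((r 0 - r 2) * (r 1 - r 0) * (r 1 - r 2)) := by
    simp [quadCoef]
    field_simp
    ring
  rw [this]
  exact div_ne_zero (mul_ne_zero (mul_ne_zero h2 h2') hil) (mul_ne_zero (mul_ne_zero h02 h10) h12)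

theorem sum_quadCoef_mul (hr : Function.Injective r) {B : Type*} [CommRing B] (κ : K →+* B)
    (c : Fin 3 → B) (t : K) :
    κ (quadCoef r t 0) * (c 0 + c 1 * κ (r 0) + c 2 * κ (r 0) ^ 2) +
      κ (quadCoef r t 1) * (c 0 + c 1 * κ (r 1) + c 2 * κ (r 1) ^ 2) +
      κ (quadCoef r t 2) * (c 0 + c 1 * κ (r 2) + c 2 * κ (r 2) ^ 2) =
    c 0 + c 1 * κ t + c 2 * κ t ^ 2 := by
  have h : ∀ a b : Fin 6, a ≠ b → r a - r b ≠ 0 := fun a b hab => sub_ne_zero.2 (hr.ne hab)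
  have h01 := h 0 1 (by decide)
  have h02 := h 0 2 (by decide)
  have h12 := h 1 2 (by decide)
  have h10 := h 1 0 (by decide)
  have h20 := h 2 0 (by decide)
  have h21 := h 2 1 (by decide)
  have e0 : quadCoef r t 0 + quadCoef r t 1 + quadCoef r t 2 = 1 := by
    simp [quadCoef]
    field_simp
    ring
  have e1 : quadCoef r t 0 * r 0 + quadCoef r t 1 * r 1 + quadCoef r t 2 * r 2 = t := by
    simp [quadCoef]
    field_simp
    ring
  have e2 : quadCoef r t 0 * r 0 ^ 2 + quadCoef r t 1 * r 1 ^ 2 + quadCoef r t 2 * r 2 ^ 2 =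
      t ^ 2 := by
    simp [quadCoef]
    field_simp
    ring
  have f0 := congrArg κ e0
  have f1 := congrArg κ e1
  have f2 := congrArg κ e2
  simp only [map_add, map_mul, map_pow, map_one] at f0 f1 f2
  linear_combination c 0 * f0 + c 1 * f1 + c 2 * f2

theorem exists_quadratic_interpolation (r : Fin 6 → K) {B : Type*} [CommRing B]
    (κ : K →+* B) (x : Fin 3 → B) : ∃ c : Fin 3 → B, ∀ t, c 0 + c 1 * κ t + c 2 * κ t ^ 2 =
      κ (quadCoef r t 0) * x 0 + κ (quadCoef r t 1) * x 1 + κ (quadCoef r t 2) * x 2 := by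
  -- These are the coefficients of 1, t, t² in the three Lagrange basis polynomials.
  refine ⟨![κ (r 1 * r 2 / ((r 0 - r 1) * (r 0 - r 2))) * x 0 +
      κ (r 0 * r 2 / ((r 1 - r 0) * (r 1 - r 2))) * x 1 +
      κ (r 0 * r 1 / ((r 2 - r 0) * (r 2 - r 1))) * x 2,
    -(κ ((r 1 + r 2) / ((r 0 - r 1) * (r 0 - r 2))) * x 0 +
      κ ((r 0 + r 2) / ((r 1 - r 0) * (r 1 - r 2))) * x 1 +
      κ ((r 0 + r 1) / ((r 2 - r 0) * (r 2 - r 1))) * x 2),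
    κ (1 / ((r 0 - r 1) * (r 0 - r 2))) * x 0 +
      κ (1 / ((r 1 - r 0) * (r 1 - r 2))) * x 1 +
      κ (1 / ((r 2 - r 0) * (r 2 - r 1))) * x 2], fun t => ?_⟩
  have key : ∀ a b d : K, (t - a) * (t - b) / d = a * b / d - (a + b) / d * t + 1 / d * t ^ 2 :=
    fun a b d => by ring
  simp [quadCoef, key, -one_div]
  ring

theorem quadCoef_node (hr : Function.Injective r) (j i : Fin 3) :
    quadCoef r (r (Fin.castLE (by decide) j)) i = if i = j then 1 else 0 := by
  have h : ∀ a b : Fin 6, a ≠ b → r a - r b ≠ 0 := fun a b hab => sub_ne_zero.2 (hr.ne hab)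
  have h01 := h 0 1 (by decide)
  have h02 := h 0 2 (by decide)
  have h12 := h 1 2 (by decide)
  have h10 := h 1 0 (by decide)
  have h20 := h 2 0 (by decide)
  have h21 := h 2 1 (by decide)
  fin_cases j <;> fin_cases i <;> simp [quadCoef, Fin.castLE, h01, h02, h12, h10, h20, h21]

end Coefficients

/-! ### Integrality of V -/

section Prime

variable {k : Type u} [Field k] {K : Type v} [Field K] [Algebra k K]
variable {f δ : k[X]} {r z : Fin 6 → K}

/-- The first three node forms, as a map from the polynomial ring in three variables to the
homogeneous coordinate ring. -/
def baseMap (f δ : k[X]) (r z : Fin 6 → K) : MvPolynomial (Fin 3) K →+* CoordRing K f δ :=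
  MvPolynomial.eval₂Hom ((toCoord K f δ).comp MvPolynomial.C)
    fun j => toCoord K f δ (nodeForm r z (Fin.castLE (by decide) j))

theorem IsFrame.nodeForm_sq (h : IsFrame f δ r z) (i : Fin 6) :
    toCoord K f δ (nodeForm r z i) ^ 2 = baseMap f δ r z (diagForm (quadCoef r (r i))) := by
  obtain ⟨c, hc⟩ := (h.surfaceIdeal_le_ker_iff (toCoord K f δ)).1 Ideal.mk_ker.ge
  have := sum_quadCoef_mul h.injective ((toCoord K f δ).comp MvPolynomial.C) c (r i)
  simp only [RingHom.comp_apply] at this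
  rw [hc, ← this, ← hc, ← hc, ← hc, diagForm, Fin.sum_univ_three]
  simp only [map_add, map_mul, map_pow, baseMap, MvPolynomial.eval₂Hom_C,
    MvPolynomial.eval₂Hom_X', RingHom.comp_apply]
  rfl

/-- The coordinate ring is compared with the domain B of `exists_tower`. The map θ into B kills the
surface ideal, and ψ leads back with ψ ∘ θ equal to the quotient map, so the surface ideal is
exactly the kernel of θ. -/
theorem IsFrame.isPrime [IsAlgClosed K] (h2 : (2 : K) ≠ 0) (h : IsFrame f δ r z) :
    (surfaceIdeal K f δ).IsPrime := by
  have hP : ∀ i : Fin 6, 3 ≤ i → Prime (diagForm (quadCoef r (r i))) := fun i hi =>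
    prime_diagForm h2 (quadCoef_ne_zero h.injective hi)
  have hN : ∀ i l : Fin 6, 3 ≤ i → 3 ≤ l → i ≠ l →
      ¬ diagForm (quadCoef r (r i)) ∣ diagForm (quadCoef r (r l)) := fun i l hi hl hil =>
    not_diagForm_dvd (quadCoef_minor h.injective hi hl hil)
  have h2' : (2 : MvPolynomial (Fin 3) K) ≠ 0 := fun h0 => h2 <| by
    have := congrArg (MvPolynomial.eval fun _ => (1 : K)) h0
    rwa [map_ofNat, map_zero] at this
  obtain ⟨B, _, _, ι, u, v, w, hu, hv, hw, huniv⟩ := exists_tower h2'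
    (hP 3 (by decide)) (hP 4 (by decide)) (hP 5 (by decide))
    (hN 3 4 (by decide) (by decide) (by decide)) (hN 3 5 (by decide) (by decide) (by decide))
    (hN 4 5 (by decide) (by decide) (by decide))
  let x : Fin 6 → B := ![ι (MvPolynomial.X 0), ι (MvPolynomial.X 1), ι (MvPolynomial.X 2), u, v, w]
  let κ : K →+* B := ι.comp MvPolynomial.C
  let θ : MvPolynomial (Fin 6) K →+* B :=
    MvPolynomial.eval₂Hom κ fun j => ∑ i, κ (lagCoeff r i j / z i) * x i
  have hθC : ∀ a, θ (MvPolynomial.C a) = κ a := fun a => MvPolynomial.eval₂Hom_C _ _ a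
  have hθx : ∀ l, θ (nodeForm r z l) = x l := by
    intro l
    rw [nodeForm, map_mul, map_sum, hθC]
    have : ∀ j : Fin 6, θ (MvPolynomial.X j * MvPolynomial.C (r l) ^ (j : ℕ)) =
        ∑ i, κ (lagCoeff r i j * r l ^ (j : ℕ)) * (κ (z i)⁻¹ * x i) := by
      intro j
      rw [map_mul, map_pow, hθC, MvPolynomial.eval₂Hom_X', Finset.sum_mul]
      refine Finset.sum_congr rfl fun i _ => ?_
      rw [div_eq_mul_inv, map_mul, map_mul, map_pow]
      ring
    simp_rw [this]
    rw [Finset.sum_comm]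
    simp_rw [← Finset.sum_mul, ← map_sum, sum_lagCoeff_mul_pow_right h.injective]
    simp only [apply_ite κ, map_one, map_zero, ite_mul, one_mul, zero_mul]
    rw [Finset.sum_ite_eq' Finset.univ l, if_pos (Finset.mem_univ l), ← mul_assoc, ← map_mul,
      mul_inv_cancel₀ (h.z_ne_zero l), map_one, one_mul]
  have hxsq : ∀ i, x i ^ 2 = κ (quadCoef r (r i) 0) * x 0 ^ 2 + κ (quadCoef r (r i) 1) * x 1 ^ 2 +
      κ (quadCoef r (r i) 2) * x 2 ^ 2 := by
    have hdiag : ∀ i, ι (diagForm (quadCoef r (r i))) = κ (quadCoef r (r i) 0) * x 0 ^ 2 +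
        κ (quadCoef r (r i) 1) * x 1 ^ 2 + κ (quadCoef r (r i) 2) * x 2 ^ 2 := by
      intro i
      rw [diagForm, Fin.sum_univ_three]
      simp only [map_add, map_mul, map_pow]
      rfl
    have hnode := quadCoef_node h.injective
    intro i
    fin_cases i
    · have := hnode 0
      simp only [Fin.castLE_zero] at this
      simp [this]
    · have := hnode 1
      change ∀ i, quadCoef r (r 1) i = _ at this
      simp [this]
    · have := hnode 2
      change ∀ i, quadCoef r (r 2) i = _ at this
      simp [this]
    · exact hu.trans (hdiag 3)
    · exact hv.trans (hdiag 4)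
    · exact hw.trans (hdiag 5)
  have hle : surfaceIdeal K f δ ≤ RingHom.ker θ := by
    rw [h.surfaceIdeal_le_ker_iff]
    -- c interpolates the squares of x 0, x 1, x 2; `hxsq` says that it gives the other three
    -- squares as well.
    obtain ⟨c, hc⟩ := exists_quadratic_interpolation r κ
      (fun j => x (Fin.castLE (by decide) j) ^ 2)
    refine ⟨c, fun i => ?_⟩
    rw [hθx, hθC, hc, hxsq]
    rfl
  obtain ⟨ψ, hψ, hψu, hψv, hψw⟩ := huniv (baseMap f δ r z) _ _ _ (h.nodeForm_sq 3)
    (h.nodeForm_sq 4) (h.nodeForm_sq 5)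
  have hψx : ∀ i, ψ (x i) = toCoord K f δ (nodeForm r z i) := by
    intro i
    fin_cases i
    · exact (hψ _).trans (MvPolynomial.eval₂Hom_X' _ _ 0)
    · exact (hψ _).trans (MvPolynomial.eval₂Hom_X' _ _ 1)
    · exact (hψ _).trans (MvPolynomial.eval₂Hom_X' _ _ 2)
    · exact hψu
    · exact hψv
    · exact hψw
  have hψκ : ∀ a, ψ (κ a) = toCoord K f δ (MvPolynomial.C a) := fun a =>
    (hψ _).trans (MvPolynomial.eval₂Hom_C _ _ a)
  have hcomp : ψ.comp θ = toCoord K f δ := by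
    refine MvPolynomial.ringHom_ext (fun a => ?_) fun j => ?_
    · rw [RingHom.comp_apply, hθC, hψκ]
    · rw [RingHom.comp_apply, MvPolynomial.eval₂Hom_X', map_sum]
      conv_rhs => rw [h.X_eq j, map_sum]
      exact Finset.sum_congr rfl fun i _ => by rw [map_mul, map_mul, hψκ, hψx]
  have hker : surfaceIdeal K f δ = RingHom.ker θ := by
    refine le_antisymm hle fun F hF => ?_
    rw [← Ideal.Quotient.eq_zero_iff_mem]
    change toCoord K f δ F = 0
    rw [← hcomp, RingHom.comp_apply, (RingHom.mem_ker).1 hF, map_zero]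
  rw [hker]
  exact RingHom.ker_isPrime θ

/-- Each x_i is a root of a monic quadratic over K[x_0, x_1, x_2]. This bounds the dimension of the
cone by 3. -/
theorem IsFrame.baseMap_isIntegral (h : IsFrame f δ r z) : (baseMap f δ r z).IsIntegral := by
  have hC : ∀ a, (baseMap f δ r z).IsIntegralElem (toCoord K f δ (MvPolynomial.C a)) := fun a => by
    have : baseMap f δ r z (MvPolynomial.C a) = toCoord K f δ (MvPolynomial.C a) :=
      MvPolynomial.eval₂Hom_C _ _ a
    rw [← this]
    exact (baseMap f δ r z).isIntegralElem_map
  have hx : ∀ i, (baseMap f δ r z).IsIntegralElem (toCoord K f δ (nodeForm r z i)) := fun i => by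
    refine ⟨Polynomial.X ^ 2 - Polynomial.C (diagForm (quadCoef r (r i))),
      Polynomial.monic_X_pow_sub_C _ two_ne_zero, ?_⟩
    simp [h.nodeForm_sq i]
  have hsum : ∀ (s : Finset (Fin 6)) (g : Fin 6 → CoordRing K f δ),
      (∀ i, (baseMap f δ r z).IsIntegralElem (g i)) →
      (baseMap f δ r z).IsIntegralElem (∑ i ∈ s, g i) := by
    intro s g hg
    induction s using Finset.cons_induction with
    | empty => simpa using (baseMap f δ r z).isIntegralElem_zero
    | cons a s ha ih =>
      rw [Finset.sum_cons]
      exact (hg a).add _ ih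
  intro b
  obtain ⟨F, rfl⟩ := Ideal.Quotient.mk_surjective b
  change (baseMap f δ r z).IsIntegralElem (toCoord K f δ F)
  induction F using MvPolynomial.induction_on with
  | C a => exact hC a
  | add p q hp hq =>
    rw [map_add]
    exact hp.add _ hq
  | mul_X p j hp =>
    rw [map_mul]
    refine hp.mul _ ?_
    rw [h.X_eq j, map_sum]
    exact hsum _ _ fun i => by
      rw [map_mul]
      exact (hC _).mul _ (hx i)

end Prime

/-! ### Bounds on Krull dimension -/

theorem _root_.RingHom.IsIntegral.ringKrullDim_le {R S : Type*} [CommRing R] [CommRing S]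
    {φ : R →+* S} (hφ : φ.IsIntegral) : ringKrullDim S ≤ ringKrullDim R := by
  let := φ.toAlgebra
  have : Algebra.IsIntegral R S := ⟨hφ⟩
  -- Incomparability: strict inclusions of primes stay strict under contraction along an integral
  -- map.
  refine Order.krullDim_le_of_strictMono (PrimeSpectrum.comap (algebraMap R S)) ?_
  intro p q hpq
  have := q.2
  exact Ideal.IsIntegral.comap_lt_comap (R := R) (I := p.asIdeal) hpq

/-- Chains of primes below p and above p can be concatenated. -/
theorem _root_.Ideal.height_add_ringKrullDim_quotient_le {R : Type*} [CommRing R] (p : Ideal R)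
    [hp : p.IsPrime] : (p.height : WithBot ℕ∞) + ringKrullDim (R ⧸ p) ≤ ringKrullDim R := by
  have : Nonempty (PrimeSpectrum R) := ⟨⟨p, hp⟩⟩
  have h1 : ringKrullDim (R ⧸ p) = Order.coheight (⟨p, hp⟩ : PrimeSpectrum R) := by
    rw [ringKrullDim_quotient, Order.coheight_eq_krullDim_Ici]
    rfl
  rw [h1, ringKrullDim, Order.krullDim_eq_iSup_height_add_coheight_of_nonempty,
    ← WithBot.coe_add, WithBot.coe_le_coe]
  rw [show p.height = Order.height (⟨p, hp⟩ : PrimeSpectrum R) from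
    PrimeSpectrum.height_eq_orderHeight ⟨p, hp⟩]
  exact le_iSup (fun a : PrimeSpectrum R => Order.height a + Order.coheight a) ⟨p, hp⟩

section Prime

variable {k : Type u} [Field k] {K : Type v} [Field K] [Algebra k K]
variable {f δ : k[X]} {r z : Fin 6 → K}

theorem IsFrame.ringKrullDim_le (h : IsFrame f δ r z) : ringKrullDim (CoordRing K f δ) ≤ 3 := by
  refine h.baseMap_isIntegral.ringKrullDim_le.trans ?_
  rw [MvPolynomial.ringKrullDim_of_isNoetherianRing]
  simp

end Prime

theorem zmod_two_eq (a : ZMod 2) : a = 0 ∨ a = 1 := by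
  revert a
  decide

theorem sign_mul_self {K : Type*} [Field K] (a : ZMod 2) :
    (-1 : K) ^ a.val * (-1) ^ a.val = 1 := by
  rw [← mul_pow, neg_one_mul, neg_neg, one_pow]

theorem sign_add {K : Type*} [Field K] (a b : ZMod 2) :
    (-1 : K) ^ (a + b).val = (-1) ^ a.val * (-1) ^ b.val := by
  have h : (1 + 1 : ZMod 2) = 0 := by decide
  rcases zmod_two_eq a with rfl | rfl <;> rcases zmod_two_eq b with rfl | rfl <;>
    simp [h, ZMod.val_one]

theorem sign_mul_of_ne {K : Type*} [Field K] {a b : ZMod 2} (h : a ≠ b) :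
    (-1 : K) ^ a.val * (-1) ^ b.val = -1 := by
  have : a + b = 1 := by
    revert a b
    decide
  rw [← sign_add, this, ZMod.val_one, pow_one]

/-! ### The lines as prime divisors -/

section Lines

variable {k : Type u} [Field k] {K : Type v} [Field K] [Algebra k K]
variable {f δ : k[X]} {r z : Fin 6 → K}

theorem eq_of_sum_mul_pow_eq (hr : Function.Injective r) {a b : Fin 6 → K}
    (h : ∀ l, ∑ m : Fin 6, a m * r l ^ (m : ℕ) = ∑ m : Fin 6, b m * r l ^ (m : ℕ)) : a = b := by
  ext j
  rw [← sum_lagCoeff_eval hr (RingHom.id K) a j, ← sum_lagCoeff_eval hr (RingHom.id K) b j]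
  exact Finset.sum_congr rfl fun i _ => congrArg _ (h i)

theorem IsFrame.sum_linePoint (h : IsFrame f δ r z) (s : Fin 6 → ZMod 2) (t u : K) (l : Fin 6) :
    ∑ m : Fin 6, linePoint f r z s t u m * r l ^ (m : ℕ) =
      (-1) ^ (s l).val / z l * (t * r l + u) := by
  set g := (f * Polynomial.C f.leadingCoeff⁻¹).map (algebraMap k K) with hg
  have hgm : g.Monic := h.monic.map _
  have hgd : g.natDegree = 6 := by rw [hg, h.monic.natDegree_map, h.natDegree]
  set P : K[X] := gammaPoly r z s * (Polynomial.C t * Polynomial.X + Polynomial.C u) with hP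
  have hlt : (P %ₘ g).natDegree < 6 := by
    refine (Polynomial.natDegree_modByMonic_lt P hgm fun h1 => ?_).trans_eq hgd
    rw [h1, Polynomial.natDegree_one] at hgd
    omega
  have hroot : g.eval (r l) = 0 := by
    rw [hg, Polynomial.eval_map]
    exact h.eval_eq_zero l
  have key : (P %ₘ g).eval (r l) = P.eval (r l) :=
    Polynomial.eval₂_modByMonic_eq_self_of_root hroot
  rw [Polynomial.eval_eq_sum_range' hlt, ← Fin.sum_univ_eq_sum_range
    (fun j => (P %ₘ g).coeff j * r l ^ j)] at key
  refine key.trans ?_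
  rw [hP, Polynomial.eval_mul, gammaPoly,
    Lagrange.eval_interpolate_at_node _ h.injective.injOn (Finset.mem_univ l)]
  simp

theorem IsFrame.linePoint_eq (h : IsFrame f δ r z) (s : Fin 6 → ZMod 2) (t u : K) (j : Fin 6) :
    linePoint f r z s t u j = linePoint f r z s 1 0 j * t + linePoint f r z s 0 1 j * u := by
  refine congrFun (eq_of_sum_mul_pow_eq (b := fun j => linePoint f r z s 1 0 j * t +
    linePoint f r z s 0 1 j * u) h.injective fun l => ?_) j
  have : ∀ m : Fin 6, (linePoint f r z s 1 0 m * t + linePoint f r z s 0 1 m * u) *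
      r l ^ (m : ℕ) = t * (linePoint f r z s 1 0 m * r l ^ (m : ℕ)) +
        u * (linePoint f r z s 0 1 m * r l ^ (m : ℕ)) := fun m => by ring
  simp_rw [this]
  rw [Finset.sum_add_distrib, ← Finset.mul_sum, ← Finset.mul_sum, h.sum_linePoint,
    h.sum_linePoint, h.sum_linePoint]
  ring

/-- Restriction of forms to the line `L_s`, with its coordinates `t, u`. -/
def lineRestrict (f : k[X]) (r z : Fin 6 → K) (s : Fin 6 → ZMod 2) :
    MvPolynomial (Fin 6) K →ₐ[K] MvPolynomial (Fin 2) K :=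
  MvPolynomial.aeval fun j => MvPolynomial.C (linePoint f r z s 1 0 j) * MvPolynomial.X 0 +
    MvPolynomial.C (linePoint f r z s 0 1 j) * MvPolynomial.X 1

theorem IsFrame.eval_lineRestrict (h : IsFrame f δ r z) (s : Fin 6 → ZMod 2) (v : Fin 2 → K)
    (F : MvPolynomial (Fin 6) K) : MvPolynomial.eval v (lineRestrict f r z s F) =
      MvPolynomial.eval (linePoint f r z s (v 0) (v 1)) F := by
  have : (MvPolynomial.eval v).comp (lineRestrict f r z s).toRingHom =
      MvPolynomial.eval (linePoint f r z s (v 0) (v 1)) := by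
    refine MvPolynomial.ringHom_ext (fun a => ?_) fun j => ?_
    · simp [lineRestrict]
    · simp [lineRestrict, h.linePoint_eq s (v 0) (v 1) j]
  exact congrFun (congrArg DFunLike.coe this) F

theorem IsFrame.lineRestrict_nodeForm [Infinite K] (h : IsFrame f δ r z) (s : Fin 6 → ZMod 2)
    (l : Fin 6) : lineRestrict f r z s (nodeForm r z l) = MvPolynomial.C ((-1) ^ (s l).val) *
      (MvPolynomial.C (r l) * MvPolynomial.X 0 + MvPolynomial.X 1) := by
  refine MvPolynomial.funext fun v => ?_
  rw [h.eval_lineRestrict, nodeForm]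
  simp only [map_mul, map_sum, map_pow, MvPolynomial.eval_C, MvPolynomial.eval_X, map_add,
    h.sum_linePoint]
  have := h.z_ne_zero l
  field_simp

theorem IsFrame.mem_vanishingIdeal_iff [Infinite K] (h : IsFrame f δ r z) (s : Fin 6 → ZMod 2)
    (F : MvPolynomial (Fin 6) K) : F ∈ MvPolynomial.vanishingIdeal K
      (Set.range fun tu : K × K => linePoint f r z s tu.1 tu.2) ↔ lineRestrict f r z s F = 0 := by
  rw [MvPolynomial.mem_vanishingIdeal_iff]
  constructor
  · intro hF
    refine MvPolynomial.funext fun v => ?_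
    rw [h.eval_lineRestrict, map_zero]
    exact hF _ ⟨(v 0, v 1), rfl⟩
  · rintro hF _ ⟨⟨t, u⟩, rfl⟩
    have := h.eval_lineRestrict s ![t, u] F
    rw [hF, map_zero] at this
    exact this.symm

theorem IsFrame.surfaceIdeal_le_ker_lineRestrict [Infinite K] (h : IsFrame f δ r z)
    (s : Fin 6 → ZMod 2) :
    surfaceIdeal K f δ ≤ RingHom.ker (lineRestrict f r z s).toRingHom := by
  rw [h.surfaceIdeal_le_ker_iff]
  -- On a line the polynomial c is (t x + u)², whatever the signs s; here t is `X 0` and u is `X 1`.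
  refine ⟨![MvPolynomial.X 1 ^ 2, 2 * MvPolynomial.X 0 * MvPolynomial.X 1, MvPolynomial.X 0 ^ 2],
    fun i => ?_⟩
  change lineRestrict f r z s _ ^ 2 = _ + _ * lineRestrict f r z s _ +
    _ * lineRestrict f r z s _ ^ 2
  rw [h.lineRestrict_nodeForm, mul_pow, ← map_pow, pow_two ((-1 : K) ^ _), sign_mul_self]
  have : lineRestrict f r z s (MvPolynomial.C (r i)) = MvPolynomial.C (r i) :=
    (lineRestrict f r z s).commutes (r i)
  rw [this]
  simp
  ring

theorem IsFrame.mem_lineIdeal_iff [Infinite K] (h : IsFrame f δ r z) (s : Fin 6 → ZMod 2)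
    (F : MvPolynomial (Fin 6) K) :
    toCoord K f δ F ∈ lineIdeal f δ r z s ↔ lineRestrict f r z s F = 0 := by
  rw [lineIdeal, Ideal.mem_map_iff_of_surjective _ Ideal.Quotient.mk_surjective]
  constructor
  · rintro ⟨G, hG, hGF⟩
    rw [h.mem_vanishingIdeal_iff] at hG
    have := h.surfaceIdeal_le_ker_lineRestrict s (Ideal.Quotient.eq.1 hGF)
    change lineRestrict f r z s (G - F) = 0 at this
    rw [map_sub, hG, zero_sub, neg_eq_zero] at this
    exact this
  · intro hF
    exact ⟨F, (h.mem_vanishingIdeal_iff s F).2 hF, rfl⟩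

/-- Restriction of elements of the homogeneous coordinate ring to the line `L_s`. -/
def IsFrame.lineRestrictCoord [Infinite K] (h : IsFrame f δ r z) (s : Fin 6 → ZMod 2) :
    CoordRing K f δ →+* MvPolynomial (Fin 2) K :=
  Ideal.Quotient.lift _ (lineRestrict f r z s).toRingHom fun _ ha =>
    h.surfaceIdeal_le_ker_lineRestrict s ha

theorem IsFrame.lineRestrictCoord_surjective [Infinite K] (h : IsFrame f δ r z)
    (s : Fin 6 → ZMod 2) : Function.Surjective (h.lineRestrictCoord s) := by
  suffices hs : (lineRestrict f r z s).range = ⊤ by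
    intro G
    obtain ⟨F, rfl⟩ := (AlgHom.range_eq_top _).1 hs G
    exact ⟨toCoord K f δ F, rfl⟩
  have h01 : r 0 - r 1 ≠ 0 := sub_ne_zero.2 (h.injective.ne (by decide))
  have hmem : ∀ l : Fin 6, MvPolynomial.C (r l) * MvPolynomial.X 0 + MvPolynomial.X 1 ∈
      (lineRestrict f r z s).range := by
    intro l
    refine ⟨MvPolynomial.C ((-1) ^ (s l).val) * nodeForm r z l, ?_⟩
    have : lineRestrict f r z s (MvPolynomial.C ((-1) ^ (s l).val)) =
        MvPolynomial.C ((-1) ^ (s l).val) := (lineRestrict f r z s).commutes _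
    change lineRestrict f r z s _ = _
    rw [map_mul, this, h.lineRestrict_nodeForm, ← mul_assoc, ← map_mul, sign_mul_self, map_one,
      one_mul]
  have hX0 : (MvPolynomial.X 0 : MvPolynomial (Fin 2) K) ∈ (lineRestrict f r z s).range := by
    have := Subalgebra.smul_mem _ (sub_mem (hmem 0) (hmem 1)) (r 0 - r 1)⁻¹
    convert this using 1
    rw [add_sub_add_right_eq_sub, ← sub_mul, ← map_sub, MvPolynomial.smul_eq_C_mul, ← mul_assoc,
      ← map_mul, inv_mul_cancel₀ h01, map_one, one_mul]
  have hX1 : (MvPolynomial.X 1 : MvPolynomial (Fin 2) K) ∈ (lineRestrict f r z s).range := by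
    have := sub_mem (hmem 0) (Subalgebra.smul_mem _ hX0 (r 0))
    rwa [MvPolynomial.smul_eq_C_mul, add_sub_cancel_left] at this
  rw [← top_le_iff, ← MvPolynomial.adjoin_range_X, Algebra.adjoin_le_iff]
  rintro _ ⟨j, rfl⟩
  fin_cases j
  · exact hX0
  · exact hX1

theorem IsFrame.lineIdeal_eq_ker [Infinite K] (h : IsFrame f δ r z) (s : Fin 6 → ZMod 2) :
    lineIdeal f δ r z s = RingHom.ker (h.lineRestrictCoord s) := by
  ext a
  obtain ⟨F, rfl⟩ := Ideal.Quotient.mk_surjective a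
  exact h.mem_lineIdeal_iff s F

/-- A linear form vanishing on the lines `L_s'` such that `s'` and `s` agree at `0`, `1`, `i`. -/
def relForm (r z : Fin 6 → K) (s : Fin 6 → ZMod 2) (i : Fin 6) : MvPolynomial (Fin 6) K :=
  MvPolynomial.C ((-1) ^ (s 0).val * (r 1 - r i)) * nodeForm r z 0 +
    MvPolynomial.C ((-1) ^ (s 1).val * (r i - r 0)) * nodeForm r z 1 +
    MvPolynomial.C ((-1) ^ (s i).val * (r 0 - r 1)) * nodeForm r z i

/-- The binary forms r_l t + u for l = 0, 1, i satisfy a linear relation with coefficients r_1 -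
r_i, r_i - r_0, r_0 - r_1. The form thus vanishes on the line if the signs at i agree, and otherwise
detects the difference. -/
theorem IsFrame.lineRestrict_relForm [Infinite K] (h : IsFrame f δ r z) {s s' : Fin 6 → ZMod 2}
    (h0 : s' 0 = s 0) (h1 : s' 1 = s 1) (i : Fin 6) :
    lineRestrict f r z s' (relForm r z s i) =
      MvPolynomial.C (((-1) ^ (s i).val * (-1) ^ (s' i).val - 1) * (r 0 - r 1)) *
        (MvPolynomial.C (r i) * MvPolynomial.X 0 + MvPolynomial.X 1) := by
  have hC : ∀ a, lineRestrict f r z s' (MvPolynomial.C a) = MvPolynomial.C a :=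
    (lineRestrict f r z s').commutes
  refine MvPolynomial.funext fun v => ?_
  simp only [relForm, map_add, map_mul (lineRestrict f r z s'), hC, h.lineRestrict_nodeForm, h0,
    h1]
  simp only [map_add, map_mul, MvPolynomial.eval_C, MvPolynomial.eval_X]
  have e0 := sign_mul_self (K := K) (s 0)
  have e1 := sign_mul_self (K := K) (s 1)
  linear_combination (r 1 - r i) * (r 0 * v 0 + v 1) * e0 + (r i - r 0) * (r 1 * v 0 + v 1) * e1

theorem IsFrame.relForm_mem [Infinite K] (h : IsFrame f δ r z) {s s' : Fin 6 → ZMod 2}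
    {i : Fin 6} (h0 : s' 0 = s 0) (h1 : s' 1 = s 1) (hi : s' i = s i) :
    toCoord K f δ (relForm r z s i) ∈ lineIdeal f δ r z s' := by
  rw [h.mem_lineIdeal_iff, h.lineRestrict_relForm h0 h1, hi, sign_mul_self]
  simp

theorem IsFrame.relForm_notMem [Infinite K] (h2 : (2 : K) ≠ 0) (h : IsFrame f δ r z)
    {s s' : Fin 6 → ZMod 2} {i : Fin 6} (h0 : s' 0 = s 0) (h1 : s' 1 = s 1) (hi : s' i ≠ s i) :
    toCoord K f δ (relForm r z s i) ∉ lineIdeal f δ r z s' := by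
  rw [h.mem_lineIdeal_iff, h.lineRestrict_relForm h0 h1, sign_mul_of_ne hi.symm]
  intro hc
  have := congrArg (MvPolynomial.eval ![0, 1]) hc
  simp at this
  have h01 : r 0 - r 1 ≠ 0 := sub_ne_zero.2 (h.injective.ne (by decide))
  rcases this with h3 | h3
  · exact h2 (by linear_combination -h3)
  · exact h01 h3

theorem IsFrame.lineIdeal_ne [Infinite K] (h2 : (2 : K) ≠ 0) (h : IsFrame f δ r z)
    {s s' : Fin 6 → ZMod 2} (h0 : s' 0 = s 0) (h1 : s' 1 = s 1) {i : Fin 6} (hi : s' i ≠ s i) :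
    lineIdeal f δ r z s' ≠ lineIdeal f δ r z s := by
  intro he
  have hm := h.relForm_notMem h2 h0 h1 hi
  rw [he] at hm
  exact hm (h.relForm_mem rfl rfl rfl)

/-- The quotient has dimension 2, which leaves height at most 1, and a nonzero prime of a domain has
positive height. -/
theorem _root_.RingHom.height_ker_eq_one {R : Type*} [CommRing R] [IsDomain R]
    (hR : ringKrullDim R ≤ 3) {φ : R →+* MvPolynomial (Fin 2) K} (hφ : Function.Surjective φ)
    (hne : RingHom.ker φ ≠ ⊥) : (RingHom.ker φ).height = 1 := by
  have hP : (RingHom.ker φ).IsPrime := RingHom.ker_isPrime φ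
  have hdim : ringKrullDim (R ⧸ RingHom.ker φ) = 2 := by
    rw [ringKrullDim_eq_of_ringEquiv (RingHom.quotientKerEquivOfSurjective hφ),
      MvPolynomial.ringKrullDim_of_isNoetherianRing]
    simp
  have hle := (RingHom.ker φ).height_add_ringKrullDim_quotient_le.trans hR
  rw [hdim] at hle
  have h3 : ((RingHom.ker φ).height + 2 : ℕ∞) ≤ 1 + 2 := by
    have : (3 : WithBot ℕ∞) = ((1 + 2 : ℕ∞) : WithBot ℕ∞) := by norm_num
    rw [this] at hle
    exact WithBot.coe_le_coe.1 hle
  refine le_antisymm ((ENat.add_le_add_iff_right (by simp)).1 h3)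
    (Order.one_le_iff_ne_zero.2 fun h0 => hne ?_)
  rwa [Ideal.height_eq_zero_iff_eq_bot] at h0

theorem IsFrame.lineIdeal_isPrime [Infinite K] (h : IsFrame f δ r z) (s : Fin 6 → ZMod 2) :
    (lineIdeal f δ r z s).IsPrime := by
  rw [h.lineIdeal_eq_ker]
  exact RingHom.ker_isPrime _

theorem isHomogeneous_lineRestrict {F : MvPolynomial (Fin 6) K} {m : ℕ} (hF : F.IsHomogeneous m)
    (f : k[X]) (r z : Fin 6 → K) (s : Fin 6 → ZMod 2) :
    (lineRestrict f r z s F).IsHomogeneous m := by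
  have := hF.aeval (n := 1) (fun j => MvPolynomial.C (linePoint f r z s 1 0 j) *
    MvPolynomial.X 0 + MvPolynomial.C (linePoint f r z s 0 1 j) * MvPolynomial.X 1 :
      Fin 6 → MvPolynomial (Fin 2) K)
    fun j => ((MvPolynomial.isHomogeneous_X K 0).C_mul _).add
      ((MvPolynomial.isHomogeneous_X K 1).C_mul _)
  rwa [one_mul] at this

theorem lineRestrict_homogeneousComponent {s : Fin 6 → ZMod 2} {F : MvPolynomial (Fin 6) K}
    (hF : lineRestrict f r z s F = 0) (n : ℕ) :
    lineRestrict f r z s (MvPolynomial.homogeneousComponent n F) = 0 := by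
  have hsum := congrArg (fun G => MvPolynomial.homogeneousComponent n (lineRestrict f r z s G))
    (MvPolynomial.sum_homogeneousComponent F)
  simp only [map_sum, hF, map_zero] at hsum
  simp_rw [MvPolynomial.homogeneousComponent_of_mem (isHomogeneous_lineRestrict
    (MvPolynomial.homogeneousComponent_isHomogeneous _ F) f r z s)] at hsum
  rw [Finset.sum_ite_eq] at hsum
  by_cases hn : n ∈ Finset.range (F.totalDegree + 1)
  · rwa [if_pos hn] at hsum
  · rw [MvPolynomial.homogeneousComponent_eq_zero, map_zero]
    rw [Finset.mem_range] at hn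
    omega

theorem IsFrame.height_lineIdeal [IsAlgClosed K] (h2 : (2 : K) ≠ 0) (h : IsFrame f δ r z)
    (s : Fin 6 → ZMod 2) : (lineIdeal f δ r z s).height = 1 := by
  have : Infinite K := IsAlgClosed.instInfinite
  have hV := h.isPrime h2
  rw [h.lineIdeal_eq_ker]
  refine RingHom.height_ker_eq_one h.ringKrullDim_le (h.lineRestrictCoord_surjective s) ?_
  rw [← h.lineIdeal_eq_ker]
  intro h0
  have hm := h.relForm_mem (s := s) (s' := s) (i := 2) rfl rfl rfl
  rw [h0, Ideal.mem_bot] at hm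
  -- A zero ideal would make `relForm` zero, hence vanishing also on the line with the sign at 2
  -- flipped.
  refine h.relForm_notMem h2 (s := s) (s' := Function.update s 2 (s 2 + 1)) (i := 2)
    (by simp) (by simp) (by simp) ?_
  rw [hm]
  exact zero_mem _

/-- The line `L_s` as a prime divisor. -/
def IsFrame.lineDivisor [IsAlgClosed K] (h2 : (2 : K) ≠ 0) (h : IsFrame f δ r z)
    (s : Fin 6 → ZMod 2) : PrimeDivisor K f δ where
  ideal := lineIdeal f δ r z s
  isPrime :=
    have : Infinite K := IsAlgClosed.instInfinite
    h.lineIdeal_isPrime s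
  homogeneous F n hF := by
    have : Infinite K := IsAlgClosed.instInfinite
    rw [h.mem_lineIdeal_iff] at hF ⊢
    exact lineRestrict_homogeneousComponent hF n
  height_eq_one := h.height_lineIdeal h2 s

end Lines

/-! ### The Galois action on the lines -/

section LineAction

variable {k : Type u} [Field k] {K : Type v} [Field K] [Algebra k K]
variable {f δ : k[X]} {r z : Fin 6 → K} {σ : Gal(K/k)} {t s s' : Fin 6 → ZMod 2}
  {π : Equiv.Perm (Fin 6)}

/-- Both sides are compared through their values at the nodes r (π i). The sign by which σ
multiplies z in the denominator is its own inverse, so it adds t (π i) to s i. -/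
theorem IsFrame.linePoint_act (h : IsFrame f δ r z) (hσ : Induces r z σ t π)
    (hs : ∀ i, s' (π i) = s i + t (π i)) (a b : K) :
    linePoint f r z s' (σ a) (σ b) = fun j => σ (linePoint f r z s a b j) := by
  refine eq_of_sum_mul_pow_eq h.injective fun l => ?_
  obtain ⟨i, rfl⟩ := π.surjective l
  have h1 : ∑ m : Fin 6, σ (linePoint f r z s a b m) * r (π i) ^ (m : ℕ) =
      σ (∑ m : Fin 6, linePoint f r z s a b m * r i ^ (m : ℕ)) := by
    rw [map_sum]
    exact Finset.sum_congr rfl fun m _ => by rw [map_mul, map_pow, (hσ i).1]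
  rw [h1, h.sum_linePoint, h.sum_linePoint, map_mul, map_div₀, map_add, map_mul, (hσ i).1,
    (hσ i).2, map_pow, map_neg, map_one, hs, sign_add]
  congr 1
  have := sign_mul_self (K := K) (t (π i))
  have h2 : ((-1 : K) ^ (t (π i)).val) ≠ 0 := left_ne_zero_of_mul_eq_one this
  have h3 := h.z_ne_zero (π i)
  field_simp
  rw [pow_two, this]

theorem IsFrame.mem_lineIdeal_iff_eval [Infinite K] (h : IsFrame f δ r z)
    (F : MvPolynomial (Fin 6) K) : toCoord K f δ F ∈ lineIdeal f δ r z s ↔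
      ∀ a b, MvPolynomial.eval (linePoint f r z s a b) F = 0 := by
  rw [h.mem_lineIdeal_iff, ← h.mem_vanishingIdeal_iff, MvPolynomial.mem_vanishingIdeal_iff]
  constructor
  · exact fun hF a b => hF _ ⟨(a, b), rfl⟩
  · rintro hF _ ⟨⟨a, b⟩, rfl⟩
    exact hF a b

theorem IsFrame.actCoord_mem_lineIdeal_iff [Infinite K] (h : IsFrame f δ r z)
    (hσ : Induces r z σ t π) (hs : ∀ i, s' (π i) = s i + t (π i)) (a : CoordRing K f δ) :
    actCoord f δ σ a ∈ lineIdeal f δ r z s' ↔ a ∈ lineIdeal f δ r z s := by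
  obtain ⟨F, rfl⟩ := Ideal.Quotient.mk_surjective a
  change toCoord K f δ (actPoly σ F) ∈ _ ↔ toCoord K f δ F ∈ _
  have key : ∀ a b, MvPolynomial.eval (linePoint f r z s' (σ a) (σ b)) (actPoly σ F) =
      σ (MvPolynomial.eval (linePoint f r z s a b) F) := by
    intro a b
    rw [h.linePoint_act hσ hs, actPoly, MvPolynomial.mapEquiv_apply, MvPolynomial.eval_map]
    exact (MvPolynomial.eval₂_comp_left (σ : K →+* K) (RingHom.id K) _ F).symm
  rw [h.mem_lineIdeal_iff_eval, h.mem_lineIdeal_iff_eval]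
  constructor
  · intro hF a b
    exact (map_eq_zero_iff σ σ.injective).1 (key a b ▸ hF _ _)
  · intro hF a b
    obtain ⟨a, rfl⟩ := σ.surjective a
    obtain ⟨b, rfl⟩ := σ.surjective b
    rw [key, hF, map_zero]

open Classical in
theorem lineDiv_apply (P : PrimeDivisor K f δ) :
    lineDiv f δ r z s P = if P.ideal = lineIdeal f δ r z s then 1 else 0 := rfl

theorem IsFrame.act_lineDiv [Infinite K] (h : IsFrame f δ r z)
    (hσ : Induces r z σ t π) (hs : ∀ i, s' (π i) = s i + t (π i)) :
    Divisor.act σ (lineDiv f δ r z s) = lineDiv f δ r z s' := by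
  ext P
  obtain ⟨P, rfl⟩ := (PrimeDivisor.act_bijective σ).2 P
  rw [Divisor.act_apply, lineDiv_apply, lineDiv_apply]
  symm
  congr 1
  rw [eq_iff_iff, Ideal.ext_iff, Ideal.ext_iff, (actCoord f δ σ).surjective.forall]
  refine forall_congr' fun a => ?_
  rw [P.mem_act_iff σ, h.actCoord_mem_lineIdeal_iff hσ hs]

theorem lineSum_apply_ne_zero {P : PrimeDivisor K f δ} (hP : P.ideal = lineIdeal f δ r z s)
    {I : Fin 3 → Fin 6} {B : Fin 3 → ZMod 2} (hs : ∀ j, s (I j) = B j) :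
    lineSum f δ r z I B P ≠ 0 := by
  classical
  rw [lineSum, Finsupp.finsetSum_apply]
  refine (Finset.sum_pos' (fun s' _ => ?_) ⟨s, by simpa using hs, ?_⟩).ne'
  · rw [lineDiv_apply]
    split_ifs <;> simp
  · rw [lineDiv_apply, if_pos hP]
    exact one_pos

theorem lineSum_apply_eq_zero {P : PrimeDivisor K f δ} {I : Fin 3 → Fin 6} {B : Fin 3 → ZMod 2}
    (hP : ∀ s : Fin 6 → ZMod 2, (∀ j, s (I j) = B j) → P.ideal ≠ lineIdeal f δ r z s) :
    lineSum f δ r z I B P = 0 := by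
  classical
  rw [lineSum, Finsupp.finsetSum_apply]
  refine Finset.sum_eq_zero fun s hs => ?_
  rw [lineDiv_apply, if_neg (hP s (by simpa using hs))]

/-- The sum of the two lines `L_s` with `s = (0, 0, a, b, c, *)`. -/
def linePair (f δ : k[X]) (r z : Fin 6 → K) (a b c : ZMod 2) : Divisor K f δ :=
  lineDiv f δ r z ![0, 0, a, b, c, 0] + lineDiv f δ r z ![0, 0, a, b, c, 1]

theorem sum_zmod_two {G : Type*} [AddCommMonoid G] (g : ZMod 2 → G) :
    ∑ y, g y = g 0 + g 1 := Fin.sum_univ_two g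

/-- The hyperplane sections are grouped into pairs of lines differing in the last sign. All later
divisor identities are linear in the eight pairs. -/
theorem lineSum_2 (x : ZMod 2) : lineSum f δ r z ![0, 1, 2] ![0, 0, x] =
    linePair f δ r z x 0 0 + linePair f δ r z x 0 1 + linePair f δ r z x 1 0 +
      linePair f δ r z x 1 1 := by
  have : lineSum f δ r z ![0, 1, 2] ![0, 0, x] =
      ∑ y : ZMod 2 × ZMod 2 × ZMod 2, lineDiv f δ r z ![0, 0, x, y.1, y.2.1, y.2.2] := by
    symm
    refine Finset.sum_bij (fun y _ => ![0, 0, x, y.1, y.2.1, y.2.2]) ?_ ?_ ?_ fun _ _ => rfl <;>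
      (revert x; decide)
  simp only [this, Fintype.sum_prod_type, sum_zmod_two, linePair]
  abel

theorem lineSum_3 (x : ZMod 2) : lineSum f δ r z ![0, 1, 3] ![0, 0, x] =
    linePair f δ r z 0 x 0 + linePair f δ r z 0 x 1 + linePair f δ r z 1 x 0 +
      linePair f δ r z 1 x 1 := by
  have : lineSum f δ r z ![0, 1, 3] ![0, 0, x] =
      ∑ y : ZMod 2 × ZMod 2 × ZMod 2, lineDiv f δ r z ![0, 0, y.1, x, y.2.1, y.2.2] := by
    symm
    refine Finset.sum_bij (fun y _ => ![0, 0, y.1, x, y.2.1, y.2.2]) ?_ ?_ ?_ fun _ _ => rfl <;>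
      (revert x; decide)
  simp only [this, Fintype.sum_prod_type, sum_zmod_two, linePair]
  abel

theorem lineSum_4 (x : ZMod 2) : lineSum f δ r z ![0, 1, 4] ![0, 0, x] =
    linePair f δ r z 0 0 x + linePair f δ r z 0 1 x + linePair f δ r z 1 0 x +
      linePair f δ r z 1 1 x := by
  have : lineSum f δ r z ![0, 1, 4] ![0, 0, x] =
      ∑ y : ZMod 2 × ZMod 2 × ZMod 2, lineDiv f δ r z ![0, 0, y.1, y.2.1, x, y.2.2] := by
    symm
    refine Finset.sum_bij (fun y _ => ![0, 0, y.1, y.2.1, x, y.2.2]) ?_ ?_ ?_ fun _ _ => rfl <;>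
      (revert x; decide)
  simp only [this, Fintype.sum_prod_type, sum_zmod_two, linePair]
  abel

/-- A constant triple is unaffected by the permutation of 2, 3, 4, so its image depends on t alone;
t 5 = 0 preserves the last sign of each line. -/
theorem IsFrame.act_linePair [Infinite K] (h : IsFrame f δ r z) (hσ : Induces r z σ t π)
    (ht0 : t 0 = 0) (ht1 : t 1 = 0) (ht5 : t 5 = 0) (hπ : ∀ i, π i < 2 ↔ i < 2) (hπ5 : π 5 = 5)
    (a : ZMod 2) : Divisor.act σ (linePair f δ r z a a a) =
      linePair f δ r z (a + t 2) (a + t 3) (a + t 4) := by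
  have hs : ∀ e : ZMod 2, ∀ i, (![0, 0, a + t 2, a + t 3, a + t 4, e] : Fin 6 → ZMod 2) (π i) =
      (![0, 0, a, a, a, e] : Fin 6 → ZMod 2) i + t (π i) := by
    intro e i
    have h1 := hπ i
    have h5 : π i = 5 ↔ i = 5 := by
      rw [← π.injective.eq_iff (a := i), hπ5]
    generalize π i = j at h1 h5
    have h25 : ∀ m : Fin 6, m < 2 ∧ (m = 0 ∨ m = 1) ∨ ¬ m < 2 ∧ m ≠ 5 ∧ (m = 2 ∨ m = 3 ∨ m = 4) ∨
        m = 5 := by decide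
    rcases h25 i with ⟨hi, rfl | rfl⟩ | ⟨hi, hi5, rfl | rfl | rfl⟩ | rfl <;>
    rcases h25 j with ⟨hj, rfl | rfl⟩ | ⟨hj, hj5, rfl | rfl | rfl⟩ | rfl <;>
    first
    | exact absurd (h1.1 hj) hi
    | exact absurd (h1.2 hi) hj
    | exact absurd (h5.1 rfl) (by decide)
    | exact absurd (h5.2 rfl) (by decide)
    | simp [ht0, ht1, ht5]
  rw [linePair, Divisor.act_add, h.act_lineDiv hσ (hs 0), h.act_lineDiv hσ (hs 1), linePair]

end LineAction

/-! ### Invariance of E - div h -/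

section Invariance

/-- The second elementary symmetric function of the entries `2`, `3`, `4`. -/
def symTwo {A : Type*} [CommRing A] (x : Fin 6 → A) : A :=
  x 2 * x 3 + x 2 * x 4 + x 3 * x 4

theorem perm_mem_middle {π : Equiv.Perm (Fin 6)} (hπ : ∀ i, π i < 2 ↔ i < 2) (hπ5 : π 5 = 5)
    {i : Fin 6} (hi : i = 2 ∨ i = 3 ∨ i = 4) : π i = 2 ∨ π i = 3 ∨ π i = 4 := by
  have h1 := hπ i
  have h5 : π i = 5 ↔ i = 5 := by rw [← π.injective.eq_iff (a := i), hπ5]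
  generalize π i = j at h1 h5
  revert i j
  decide

theorem symTwo_comp_perm {A : Type*} [CommRing A] (x : Fin 6 → A) {π : Equiv.Perm (Fin 6)}
    (hπ : ∀ i, π i < 2 ↔ i < 2) (hπ5 : π 5 = 5) : symTwo (fun i => x (π i)) = symTwo x := by
  have h23 : π 2 ≠ π 3 := π.injective.ne (by decide)
  have h24 : π 2 ≠ π 4 := π.injective.ne (by decide)
  have h34 : π 3 ≠ π 4 := π.injective.ne (by decide)
  simp only [symTwo]
  rcases perm_mem_middle hπ hπ5 (i := 2) (by decide) with h2 | h2 | h2 <;>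
  rcases perm_mem_middle hπ hπ5 (i := 3) (by decide) with h3 | h3 | h3 <;>
  rcases perm_mem_middle hπ hπ5 (i := 4) (by decide) with h4 | h4 | h4 <;>
  first
  | exact absurd (h2.trans h3.symm) h23
  | exact absurd (h2.trans h4.symm) h24
  | exact absurd (h3.trans h4.symm) h34
  | (rw [h2, h3, h4] <;> ring)

variable {k : Type u} [Field k] {K : Type v} [Field K] [Algebra k K]
variable {f δ : k[X]} {r z : Fin 6 → K} {p q : Fin 6 → MvPolynomial (Fin 6) K}

theorem IsFrame.formDiv_eq [(surfaceIdeal K f δ).IsPrime] (h : IsFrame f δ r z)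
    {F : MvPolynomial (Fin 6) K} {D : Divisor K f δ} (hF : CutsOut F D) :
    formDiv (toCoord K f δ F) = D := by
  ext P
  rw [formDiv_apply (h.toCoord_ne_zero hF.linear hF.ne_zero), hF.ord_eq]

/-- The numerator `p₃ p₄ + p₃ p₅ + p₄ p₅ + p₃ q₃` of `h` (in the numbering `1, …, 6`). -/
def hNum (f δ : k[X]) (p q : Fin 6 → MvPolynomial (Fin 6) K) : CoordRing K f δ :=
  symTwo (fun i => toCoord K f δ (p i)) + toCoord K f δ (p 2) * toCoord K f δ (q 2)

/-- Clearing denominators leaves the term p 4 * q 4, which Condition 3 replaces by p 2 * q 2; the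
resulting numerator is symmetric. -/
theorem hFun_mul_eq [(surfaceIdeal K f δ).IsPrime] (h3 : toCoord K f δ (p 3) ≠ 0)
    (h4 : toCoord K f δ (p 4) ≠ 0) (h₃ : Condition3 f δ p q) :
    (hFun p q : FracField K f δ) *
      algebraMap _ (FracField K f δ) (toCoord K f δ (p 3) * toCoord K f δ (p 4)) =
    algebraMap _ (FracField K f δ) (hNum f δ p q) := by
  have hinj := IsFractionRing.injective (CoordRing K f δ) (FracField K f δ)
  have h42 := congrArg (algebraMap _ (FracField K f δ)) (h₃ 4 (by simp) 2 (by simp))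
  have h3' : algebraMap _ (FracField K f δ) (toCoord K f δ (p 3)) ≠ 0 :=
    (map_ne_zero_iff _ hinj).2 h3
  have h4' : algebraMap _ (FracField K f δ) (toCoord K f δ (p 4)) ≠ 0 :=
    (map_ne_zero_iff _ hinj).2 h4
  simp only [map_mul] at h42
  simp only [hFun, hNum, symTwo, map_add, map_mul]
  field_simp
  linear_combination h42

/-- Modulo p 2 the numerator is p 3 * p 4. The line (0,0,0,1,1,0) lies in the section p 2 = 0 but in
neither of the sections p 3 = 0 and p 4 = 0. -/
theorem IsFrame.hNum_ne_zero [IsAlgClosed K] (h2 : (2 : K) ≠ 0) (h : IsFrame f δ r z)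
    (hp : ∀ i : Fin 6, 2 ≤ i → CutsOut (p i) (lineSum f δ r z ![0, 1, i] ![0, 0, 0])) :
    hNum f δ p q ≠ 0 := by
  have : Infinite K := IsAlgClosed.instInfinite
  have hV := h.isPrime h2
  set L := h.lineDivisor h2 ![0, 0, 0, 1, 1, 0] with hL
  have hprime := L.isPrime
  have hin : toCoord K f δ (p 2) ∈ L.ideal := by
    refine mem_of_ordForm_ne_zero fun h0 => ?_
    have h1 := (hp 2 (by decide)).ord_eq L
    rw [h0, Nat.cast_zero] at h1
    refine lineSum_apply_ne_zero (s := ![0, 0, 0, 1, 1, 0]) rfl ?_ h1.symm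
    decide
  have hout : ∀ i : Fin 6, i = 3 ∨ i = 4 → toCoord K f δ (p i) ∉ L.ideal := by
    intro i hi
    have hi2 : 2 ≤ i := by
      revert i
      decide
    have hne := h.toCoord_ne_zero (hp i hi2).linear (hp i hi2).ne_zero
    rw [← ordForm_ne_zero_iff hne, not_not]
    have h1 := (hp i hi2).ord_eq L
    rw [lineSum_apply_eq_zero] at h1
    · exact_mod_cast h1
    · intro s hs
      have hs0 : s 0 = 0 := hs 0
      have hs1 : s 1 = 0 := hs 1
      have hsi : s i = 0 := hs 2
      refine h.lineIdeal_ne h2 hs0.symm hs1.symm (i := i) ?_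
      rw [hsi]
      rcases hi with rfl | rfl <;> decide
  intro h0
  have hmem : toCoord K f δ (p 3) * toCoord K f δ (p 4) ∈ L.ideal := by
    have : toCoord K f δ (p 3) * toCoord K f δ (p 4) = hNum f δ p q - toCoord K f δ (p 2) *
        (toCoord K f δ (p 3) + toCoord K f δ (p 4) + toCoord K f δ (q 2)) := by
      simp only [hNum, symTwo]
      ring
    rw [this, h0, zero_sub]
    exact neg_mem (Ideal.mul_mem_right _ _ hin)
  rcases hprime.mem_or_mem hmem with hm | hm
  · exact hout 3 (by decide) hm
  · exact hout 4 (by decide) hm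

theorem IsFrame.act_divE_sub_divOf [IsAlgClosed K] (h2 : (2 : K) ≠ 0) (h : IsFrame f δ r z)
    [(surfaceIdeal K f δ).IsPrime]
    (hp : ∀ i : Fin 6, 2 ≤ i → CutsOut (p i) (lineSum f δ r z ![0, 1, i] ![0, 0, 0]))
    (hq : ∀ i : Fin 6, 2 ≤ i → CutsOut (q i) (lineSum f δ r z ![0, 1, i] ![0, 0, 1]))
    (h₂ : Condition2 k r z p q) (h₃ : Condition3 f δ p q) {σ : Gal(K/k)} {t : Fin 6 → ZMod 2}
    {π : Equiv.Perm (Fin 6)} (hσ : Induces r z σ t π) (hH : InH96 t π) (ht5 : t 5 = 0) :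
    Divisor.act σ (divE f δ r z - divOf (hFun p q)) = divE f δ r z - divOf (hFun p q) := by
  have : Infinite K := IsAlgClosed.instInfinite
  obtain ⟨ht0, ht1, hsum, hπ, hπ5⟩ := id hH
  set P : Fin 6 → CoordRing K f δ := fun i => toCoord K f δ (p i) with hP
  set Q : Fin 6 → CoordRing K f δ := fun i => toCoord K f δ (q i) with hQ
  have hP0 : ∀ i, 2 ≤ i → P i ≠ 0 := fun i hi =>
    h.toCoord_ne_zero (hp i hi).linear (hp i hi).ne_zero
  have hQ0 : ∀ i, 2 ≤ i → Q i ≠ 0 := fun i hi =>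
    h.toCoord_ne_zero (hq i hi).linear (hq i hi).ne_zero
  set N := P 2 * Q 2 with hN
  have hPQ : ∀ i : Fin 6, i = 2 ∨ i = 3 ∨ i = 4 → P i * Q i = N := fun i hi => by
    have := h₃ i (by simpa using hi) 2 (by simp)
    rwa [map_mul, map_mul] at this
  set G := hNum f δ p q with hG
  have hG0 : G ≠ 0 := h.hNum_ne_zero h2 hp
  have hN0 : N ≠ 0 := mul_ne_zero (hP0 2 le_rfl) (hQ0 2 le_rfl)
  have h3 := hP0 3 (by decide)
  have h4 := hP0 4 (by decide)
  have hdP2 : formDiv (P 2) = _ := (h.formDiv_eq (hp 2 (by decide))).trans (lineSum_2 0)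
  have hdP3 : formDiv (P 3) = _ := (h.formDiv_eq (hp 3 (by decide))).trans (lineSum_3 0)
  have hdP4 : formDiv (P 4) = _ := (h.formDiv_eq (hp 4 (by decide))).trans (lineSum_4 0)
  have hdQ2 : formDiv (Q 2) = _ := (h.formDiv_eq (hq 2 (by decide))).trans (lineSum_2 1)
  have hdN : formDiv N = formDiv (P 2) + formDiv (Q 2) := formDiv_mul (hP0 2 le_rfl) (hQ0 2 le_rfl)
  -- `formDiv N` contains each of the eight pairs once. Adding E to the divisors of P 3 and P 4
  -- gives each pair once, with (0,0,0) once more and (1,1,1) once less.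
  have hE : divE f δ r z - divOf (hFun p q) =
      linePair f δ r z 0 0 0 - linePair f δ r z 1 1 1 + formDiv N - formDiv G := by
    rw [divOf_eq_formDiv_sub hG0 (mul_ne_zero h3 h4) (hFun_mul_eq h3 h4 h₃), formDiv_mul h3 h4,
      hdN, hdP2, hdP3, hdP4, hdQ2]
    simp only [divE, linePair]
    abel
  have hact : ∀ i : Fin 6, 2 ≤ i →
      actCoord f δ σ (P i) = (fun j => if t j = 0 then P j else Q j) (π i) ∧
      actCoord f δ σ (Q i) = (fun j => if t j = 0 then Q j else P j) (π i) := by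
    intro i hi
    obtain ⟨hz0, hz1⟩ := h₂ σ t π hH hσ i hi
    rcases zmod_two_eq (t (π i)) with h0 | h0
    · simp only [hP, hQ, actCoord_toCoord, hz0 h0, h0, if_pos, and_self]
    · simp only [hP, hQ, actCoord_toCoord, hz1 h0, h0, one_ne_zero, if_false, and_self]
  have hσN : actCoord f δ σ N = N := by
    rw [hN, map_mul, (hact 2 le_rfl).1, (hact 2 le_rfl).2]
    have := hPQ (π 2) (perm_mem_middle hπ hπ5 (by decide))
    dsimp only
    split_ifs
    · exact this
    · rwa [mul_comm]
  have hσG : actCoord f δ σ G = symTwo (fun j => if t j = 0 then P j else Q j) + N := by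
    rw [← symTwo_comp_perm _ hπ hπ5, hG, hNum, map_add, hσN, symTwo, symTwo]
    simp only [map_add, map_mul]
    rw [(hact 2 (by decide)).1, (hact 3 (by decide)).1, (hact 4 (by decide)).1]
  have hσG0 : actCoord f δ σ G ≠ 0 := (map_ne_zero_iff _ (actCoord f δ σ).injective).2 hG0
  have hGe : G = P 2 * P 3 + P 2 * P 4 + P 3 * P 4 + N := rfl
  have e3 := hPQ 3 (by decide)
  have e4 := hPQ 4 (by decide)
  have hrel : ∀ i j : Fin 6, 2 ≤ i → 2 ≤ j → P i * P j * actCoord f δ σ G = N * G →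
      formDiv (actCoord f δ σ G) = formDiv N + formDiv G - formDiv (P i) - formDiv (P j) := by
    intro i j hi hj hij
    have := congrArg formDiv hij
    rw [formDiv_mul (mul_ne_zero (hP0 i hi) (hP0 j hj)) hσG0, formDiv_mul (hP0 i hi) (hP0 j hj),
      formDiv_mul hN0 hG0] at this
    rw [← this]
    abel
  rw [hE, Divisor.act_sub, Divisor.act_add, Divisor.act_sub, Divisor.act_formDiv,
    Divisor.act_formDiv, hσN, h.act_linePair hσ ht0 ht1 ht5 hπ hπ5,
    h.act_linePair hσ ht0 ht1 ht5 hπ hπ5]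
  have h11 : (1 + 1 : ZMod 2) = 0 := by decide
  rw [Fin.sum_univ_six, ht0, ht1, ht5] at hsum
  -- Even weight leaves t = 0 or exactly two ones at i, j. In the latter cases P i * Q i = P j * Q j
  -- = N gives P i * P j * σG = N * G.
  rcases zmod_two_eq (t 2) with a2 | a2 <;> rcases zmod_two_eq (t 3) with a3 | a3 <;>
    rcases zmod_two_eq (t 4) with a4 | a4 <;>
    simp only [symTwo, a2, a3, a4, if_pos, one_ne_zero, if_false] at hσG hsum <;>
    simp only [a2, a3, a4, add_zero, zero_add, h11]
  · rw [hσG, hGe]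
  · exact absurd hsum (by decide)
  · exact absurd hsum (by decide)
  · rw [hrel 3 4 (by decide) (by decide)
      (by rw [hσG, hGe]; linear_combination (P 2 * P 4 + P 4 * Q 4) * e3 + (P 2 * P 3 + N) * e4),
      hdN, hdP2, hdP3, hdP4, hdQ2]
    abel
  · exact absurd hsum (by decide)
  · rw [hrel 2 4 (by decide) (by decide)
      (by rw [hσG, hGe]; linear_combination (P 2 * P 3 + N) * e4),
      hdN, hdP2, hdP4, hdQ2]
    abel
  · rw [hrel 2 3 (by decide) (by decide)
      (by rw [hσG, hGe]; linear_combination (P 2 * P 4 + N) * e3),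
      hdN, hdP2, hdP3, hdQ2]
    abel
  · exact absurd hsum (by decide)

end Invariance

/-! ### Automorphisms fixing z_6 act through H₉₆ -/

section Hypotheses

variable {k : Type u} [Field k] {K : Type v} [Field K] [Algebra k K]

theorem mem_of_aeval_eq_zero {g : k[X]} (hg : g ≠ 0) {S : Finset K} (hS : S.card = g.natDegree)
    (hroot : ∀ x ∈ S, Polynomial.aeval x g = 0) {x : K} (hx : Polynomial.aeval x g = 0) :
    x ∈ S := by
  classical
  by_contra hxS
  have hle : (insert x S).card ≤ (g.map (algebraMap k K)).natDegree := by
    refine Polynomial.card_le_degree_of_subset_roots fun y hy => ?_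
    rw [Polynomial.mem_roots (Polynomial.map_ne_zero hg), Polynomial.IsRoot, Polynomial.eval_map,
      ← Polynomial.aeval_def]
    rcases Finset.mem_insert.1 hy with rfl | hy
    · exact hx
    · exact hroot y hy
  rw [Finset.card_insert_of_notMem hxS, Polynomial.natDegree_map] at hle
  omega

theorem isFrame_of_aeval_eq_zero {f δ : k[X]} (hf : f.natDegree = 6) (hδ : IsCoprime δ f)
    {r z : Fin 6 → K} (hr : Function.Injective r) (hroot : ∀ i, Polynomial.aeval (r i) f = 0)
    (hz : ∀ i, z i ^ 2 = Polynomial.aeval (r i) δ) : IsFrame f δ r z := by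
  have hf0 : f ≠ 0 := by
    rintro rfl
    simp at hf
  have hm : ((f * Polynomial.C f.leadingCoeff⁻¹).map (algebraMap k K)).Monic :=
    (Polynomial.monic_mul_leadingCoeff_inv hf0).map _
  refine ⟨hr, hf0, ?_, hz, fun i h0 => ?_⟩
  · refine Polynomial.eq_of_monic_of_dvd_of_natDegree_le (Polynomial.monic_prod_X_sub_C r _) hm
      ?_ ?_
    · refine Finset.prod_dvd_of_coprime (fun i _ j _ hij =>
        Polynomial.pairwise_coprime_X_sub_C hr hij) fun i _ => ?_
      rw [Polynomial.dvd_iff_isRoot, Polynomial.IsRoot, Polynomial.eval_map, ← Polynomial.aeval_def,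
        map_mul, hroot, zero_mul]
    · rw [Polynomial.natDegree_map, Polynomial.natDegree_mul_leadingCoeff_inv _ hf0, hf,
        Polynomial.natDegree_prod_of_monic _ _ fun i _ => Polynomial.monic_X_sub_C _]
      simp
  · obtain ⟨a, b, hab⟩ := hδ
    have := congrArg (Polynomial.aeval (r i)) hab
    simp [hroot, ← hz, h0] at this

theorem sign_sum (e : Fin 6 → ZMod 2) :
    (-1 : K) ^ (∑ i, e i).val = ∏ i, (-1) ^ (e i).val := by
  rw [Fin.sum_univ_six, Fin.prod_univ_six]
  simp only [sign_add]

/-- The factorization of f over k forces π to preserve the three blocks. Writing z 0, z 1 as values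
of one polynomial over k excludes signs there, rationality of the product of all z i makes the
number of signs even, and σ (z 5) = z 5 excludes the last sign. -/
theorem exists_induces {f₂ f₃ f δ : k[X]} {r₆ : k}
    (hf₂ : Irreducible f₂) (hdeg₂ : f₂.natDegree = 2)
    (hf₃ : Irreducible f₃) (hdeg₃ : f₃.natDegree = 3)
    {r z : Fin 6 → K} (h : IsFrame f δ r z) (h2 : (2 : K) ≠ 0)
    (hr₂ : ∀ i ∈ ({0, 1} : Set (Fin 6)), Polynomial.aeval (r i) f₂ = 0)
    (hr₃ : ∀ i ∈ ({2, 3, 4} : Set (Fin 6)), Polynomial.aeval (r i) f₃ = 0)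
    (hr₆ : r 5 = algebraMap k K r₆)
    (hz₁₂ : ∃ w : k[X], z 0 = Polynomial.aeval (r 0) w ∧ z 1 = Polynomial.aeval (r 1) w)
    (hnorm : ∃ c : k, ∏ i, z i = algebraMap k K c)
    (σ : Gal(K/k)) (hσ : σ (z 5) = z 5) :
    ∃ (t : Fin 6 → ZMod 2) (π : Equiv.Perm (Fin 6)),
      Induces r z σ t π ∧ InH96 t π ∧ t 5 = 0 := by
  classical
  have hneg : (-1 : K) ≠ 1 := fun h0 => h2 (by linear_combination -h0)
  have haeval : ∀ (g : k[X]) (x : K), Polynomial.aeval (σ x) g = σ (Polynomial.aeval x g) :=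
    fun g x => Polynomial.aeval_algHom_apply (σ : K →ₐ[k] K) x g
  have hroot₂ : ∀ i : Fin 6, i < 2 → ∃ j : Fin 6, j < 2 ∧ σ (r i) = r j := by
    intro i hi
    have hS : ∀ x ∈ ({r 0, r 1} : Finset K), Polynomial.aeval x f₂ = 0 := by
      intro x hx
      simp only [Finset.mem_insert, Finset.mem_singleton] at hx
      rcases hx with rfl | rfl <;> exact hr₂ _ (by simp)
    have hmem := mem_of_aeval_eq_zero hf₂.ne_zero (x := σ (r i))
      (by rw [Finset.card_pair (h.injective.ne (by decide)), hdeg₂]) hS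
      (by
        have hi' : i = 0 ∨ i = 1 := by
          revert i
          decide
        rw [haeval, hr₂ i (by simpa using hi'), map_zero])
    simp only [Finset.mem_insert, Finset.mem_singleton] at hmem
    rcases hmem with hm | hm
    · exact ⟨0, by decide, hm⟩
    · exact ⟨1, by decide, hm⟩
  have hroot₃ : ∀ i : Fin 6, i = 2 ∨ i = 3 ∨ i = 4 →
      ∃ j : Fin 6, (j = 2 ∨ j = 3 ∨ j = 4) ∧ σ (r i) = r j := by
    intro i hi
    have hS : ∀ x ∈ ({r 2, r 3, r 4} : Finset K), Polynomial.aeval x f₃ = 0 := by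
      intro x hx
      simp only [Finset.mem_insert, Finset.mem_singleton] at hx
      rcases hx with rfl | rfl | rfl <;> exact hr₃ _ (by simp)
    have hmem := mem_of_aeval_eq_zero hf₃.ne_zero (x := σ (r i))
      (by rw [Finset.card_eq_three.2 ⟨_, _, _, h.injective.ne (by decide),
        h.injective.ne (by decide), h.injective.ne (by decide), rfl⟩, hdeg₃]) hS
      (by rw [haeval, hr₃ i (by simpa using hi), map_zero])
    simp only [Finset.mem_insert, Finset.mem_singleton] at hmem
    rcases hmem with hm | hm | hm
    · exact ⟨2, by decide, hm⟩
    · exact ⟨3, by decide, hm⟩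
    · exact ⟨4, by decide, hm⟩
  have hσ5 : σ (r 5) = r 5 := by rw [hr₆, σ.commutes]
  have hex : ∀ i, ∃ j, σ (r i) = r j ∧ (j < 2 ↔ i < 2) := by
    intro i
    have hcases : ∀ i : Fin 6, i < 2 ∨ (¬ i < 2 ∧ (i = 2 ∨ i = 3 ∨ i = 4)) ∨ i = 5 := by decide
    rcases hcases i with hi | ⟨hi, hi'⟩ | rfl
    · obtain ⟨j, hj, hij⟩ := hroot₂ i hi
      exact ⟨j, hij, by simp [hi, hj]⟩
    · obtain ⟨j, hj, hij⟩ := hroot₃ i hi'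
      refine ⟨j, hij, iff_of_false ?_ hi⟩
      rcases hj with rfl | rfl | rfl <;> decide
    · exact ⟨5, hσ5, Iff.rfl⟩
  choose g hg hg2 using hex
  have hginj : Function.Injective g := fun i j hij =>
    h.injective (σ.injective (by rw [hg, hg, hij]))
  let π : Equiv.Perm (Fin 6) := Equiv.ofBijective g (Finite.injective_iff_bijective.1 hginj)
  have hg5 : g 5 = 5 := h.injective (by rw [← hg, hσ5])
  have hzsq : ∀ i, σ (z i) ^ 2 = z (g i) ^ 2 := fun i => by
    rw [← map_pow, h.sq_eq, h.sq_eq, ← hg, haeval]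
  have hsgn : ∀ i, ∃ e : ZMod 2, σ (z i) = (-1) ^ e.val * z (g i) := by
    intro i
    rcases sq_eq_sq_iff_eq_or_eq_neg.1 (hzsq i) with h0 | h0
    · exact ⟨0, by simp [h0]⟩
    · exact ⟨1, by simp [h0, ZMod.val_one]⟩
  choose e he using hsgn
  have he0 : ∀ i, σ (z i) = z (g i) → e i = 0 := by
    intro i hi
    rcases zmod_two_eq (e i) with h0 | h0
    · exact h0
    · exfalso
      have h1 := he i
      rw [h0, hi, ZMod.val_one, pow_one] at h1
      exact hneg (mul_right_cancel₀ (h.z_ne_zero (g i)) (by rw [← h1, one_mul]))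
  have he5 : e 5 = 0 := he0 5 (by rw [hσ, hg5])
  have he01 : ∀ i : Fin 6, i < 2 → e i = 0 := by
    obtain ⟨w, hw0, hw1⟩ := hz₁₂
    have hw : ∀ i : Fin 6, i < 2 → z i = Polynomial.aeval (r i) w := by
      intro i hi
      have hi' : i = 0 ∨ i = 1 := by
        revert i
        decide
      rcases hi' with rfl | rfl
      · exact hw0
      · exact hw1
    intro i hi
    refine he0 i ?_
    rw [hw i hi, hw (g i) ((hg2 i).2 hi), ← hg, haeval]
  have hprod : ∏ i, (-1 : K) ^ (e i).val = 1 := by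
    obtain ⟨c, hc⟩ := hnorm
    have h0 : ∏ i, z i ≠ 0 := Finset.prod_ne_zero_iff.2 fun i _ => h.z_ne_zero i
    have h1 : σ (∏ i, z i) = ∏ i, z i := by rw [hc, σ.commutes]
    rw [map_prod, Finset.prod_congr rfl fun i _ => he i, Finset.prod_mul_distrib,
      show ∏ i, z (g i) = ∏ i, z i from Equiv.prod_comp π z] at h1
    exact mul_right_cancel₀ h0 (by rw [h1, one_mul])
  have hsum : ∑ i, e i = 0 := by
    rw [← sign_sum] at hprod
    rcases zmod_two_eq (∑ i, e i) with h0 | h0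
    · exact h0
    · rw [h0, ZMod.val_one, pow_one] at hprod
      exact absurd hprod hneg
  have hinv : ∀ i, π.symm (g i) = i := fun i => π.symm_apply_apply i
  have hlt : ∀ j : Fin 6, j < 2 → π.symm j < 2 := fun j hj => by
    rw [← hg2 (π.symm j), show g (π.symm j) = j from π.apply_symm_apply j]
    exact hj
  -- `Induces` reads the sign at the target index π i, while e is indexed by the source i.
  refine ⟨fun j => e (π.symm j), π, fun i => ⟨hg i, ?_⟩, ⟨he01 _ (hlt 0 (by decide)),
    he01 _ (hlt 1 (by decide)), ?_, hg2, hg5⟩, ?_⟩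
  · change _ = (-1) ^ (e (π.symm (g i))).val * z (g i)
    rw [hinv, he]
  · rw [← hsum]
    exact Equiv.sum_comp π.symm e
  · have := hinv 5
    rw [hg5] at this
    change e (π.symm 5) = 0
    rw [this, he5]

end Hypotheses

end KThree

end

theorem mainTheorem3 {k : Type*} [Field k] [NumberField k]
    (f₂ f₃ : k[X]) (r₆ : k) (f : k[X])
    (hf₂ : Irreducible f₂) (hdeg₂ : f₂.natDegree = 2)
    (hf₃ : Irreducible f₃) (hdeg₃ : f₃.natDegree = 3)
    (hf : f = f₂ * f₃ * (Polynomial.X - Polynomial.C r₆))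
    (δ : k[X]) (hδ : IsCoprime δ f)
    (r z : Fin 6 → AlgebraicClosure k)
    (hr : Function.Injective r)
    (hr₂ : ∀ i ∈ ({0, 1} : Set (Fin 6)), Polynomial.aeval (r i) f₂ = 0)
    (hr₃ : ∀ i ∈ ({2, 3, 4} : Set (Fin 6)), Polynomial.aeval (r i) f₃ = 0)
    (hr₆ : r 5 = algebraMap k (AlgebraicClosure k) r₆)
    (hz : ∀ i, z i ^ 2 = Polynomial.aeval (r i) δ)
    (hz₁₂ : ∃ w : k[X], z 0 = Polynomial.aeval (r 0) w ∧ z 1 = Polynomial.aeval (r 1) w)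
    (hnorm : ∃ c : k, ∏ i, z i = algebraMap k (AlgebraicClosure k) c)
    (p q : Fin 6 → MvPolynomial (Fin 6) (AlgebraicClosure k))
    (hp : ∀ i : Fin 6, 2 ≤ i →
      KThree.CutsOut (p i) (KThree.lineSum f δ r z ![0, 1, i] ![0, 0, 0]))
    (hq : ∀ i : Fin 6, 2 ≤ i →
      KThree.CutsOut (q i) (KThree.lineSum f δ r z ![0, 1, i] ![0, 0, 1]))
    (h₁ : KThree.Condition1 k r z p q)
    (h₂ : KThree.Condition2 k r z p q)
    (h₃ : KThree.Condition3 f δ p q) :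
    ∃ _ : (KThree.surfaceIdeal (AlgebraicClosure k) f δ).IsPrime,
      (KThree.hFun p q : KThree.FracField (AlgebraicClosure k) f δ) ≠ 0 ∧
      (KThree.divE f δ r z - KThree.divOf (KThree.hFun p q)).DefinedOver k⟮z 5⟯ := by
  
  have h2 : (2 : AlgebraicClosure k) ≠ 0 := by
    have : CharZero (AlgebraicClosure k) := charZero_of_injective_algebraMap
      (algebraMap k (AlgebraicClosure k)).injective
    exact two_ne_zero
  have hdeg : f.natDegree = 6 := by
    rw [hf, Polynomial.natDegree_mul (mul_ne_zero hf₂.ne_zero hf₃.ne_zero)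
      (Polynomial.X_sub_C_ne_zero r₆), Polynomial.natDegree_mul hf₂.ne_zero hf₃.ne_zero, hdeg₂,
      hdeg₃, Polynomial.natDegree_X_sub_C]
  have hroot : ∀ i, Polynomial.aeval (r i) f = 0 := by
    intro i
    have hcases : ∀ i : Fin 6, (i = 0 ∨ i = 1) ∨ (i = 2 ∨ i = 3 ∨ i = 4) ∨ i = 5 := by decide
    rw [hf, map_mul, map_mul]
    rcases hcases i with hi | hi | rfl
    · rw [hr₂ i (by simpa using hi), zero_mul, zero_mul]
    · rw [hr₃ i (by simpa using hi), mul_zero, zero_mul]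
    · rw [hr₆, map_sub, Polynomial.aeval_X, Polynomial.aeval_C, sub_self, mul_zero]
  have h := KThree.isFrame_of_aeval_eq_zero hdeg hδ hr hroot hz
  have hV := h.isPrime h2
  have hP0 := fun i hi => h.toCoord_ne_zero (hp i hi).linear (hp i hi).ne_zero
  refine ⟨hV, fun h0 => ?_, fun τ hτ => ?_⟩
  · have := KThree.hFun_mul_eq (hP0 3 (by decide)) (hP0 4 (by decide)) h₃
    rw [h0, zero_mul] at this
    exact h.hNum_ne_zero h2 hp
      (IsFractionRing.injective _ (KThree.FracField (AlgebraicClosure k) f δ)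
        (this.symm.trans (map_zero _).symm))
  · obtain ⟨t, π, hσ, hH, ht5⟩ := KThree.exists_induces hf₂ hdeg₂ hf₃ hdeg₃ h h2 hr₂ hr₃ hr₆ hz₁₂
      hnorm τ ((IntermediateField.mem_fixingSubgroup_iff _ _).1 hτ _
        (IntermediateField.mem_adjoin_simple_self k (z 5)))
    exact h.act_divE_sub_divOf h2 hp hq h₂ h₃ hσ hH ht5
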